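/- Let $(P,\tau_P)$ be a tracial von Neumann algebra (a von Neumann algebra with a faithful normal tracial state) of type II$_1$, and let $(\Omega,\mu)$ be a diffuse probability space, that is, every measurable set of positive measure contains a measurable subset of strictly smaller positive measure. Let $M = L^\infty(\Omega,\mu)\,\bar\otimes\,P$, with the trace $\tau=\tau_\mu\otimes\tau_P$, where $\tau_\mu(f)=\int f\,d\mu$, and write $\|x\|_{2,\tau}=\tau(x^*x)^{1/2}$. (1) $(M,\tau)$ is not countably quantifier-free saturated. Here a tracial von Neumann algebra $(A,\sigma)$ is countably quantifier-free saturated if for every sequence $(p_n)_{n\in\mathbb N}$ of $*$-polynomials with coefficients in $A$ in a finite tuple $\bar x$ of non-commuting variables, and every sequence of reals $r_n\ge 0$, the system $\|p_n(\bar x)\|_{2,\sigma}=r_n$ $(n\in\mathbb N)$ has a solution in the operator unit ball of $A$ if and only if for every $n\ge 1$ there is a tuple $\bar a$ in the operator unit ball of $A$ with $\bigl|\|p_j(\bar a)\|_{2,\sigma}-r_j\bigr|<1/n$ for all $j<n$. (2) Let $\mathcal U$ be a nonprincipal ultrafilter on $\mathbb N$, let $(N_n,\tau_n)_{n\in\mathbb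 N}$ be tracial von Neumann algebras, and let $\prod^{\mathcal U}N_n$ be their tracial ultraproduct, i.e. the quotient of the $*$-algebra of operator-norm bounded sequences $(x_n)$ with $x_n\in N_n$ by the ideal of those with $\lim_{n\to\mathcal U}\|x_n\|_{2,\tau_n}=0$, with the trace $\lim_{n\to\mathcal U}\tau_n(x_n)$. Then $M$ is not $*$-isomorphic to $\prod^{\mathcal U}N_n$, and for every $*$-subalgebra $S$ of $\prod^{\mathcal U}N_n$ that is separable in the $2$-norm, $M$ is not $*$-isomorphic to the relative commutant $S'\cap\prod^{\mathcal U}N_n$. -/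

import Mathlib

open scoped ComplexOrder TensorProduct Topology ENNReal

noncomputable section

namespace TracialVN

/-! ### Algebras with a functional: 2-norm, *-polynomials, saturation, type II₁ -/

section Algebraic

/-- The seminorm `‖x‖₂ = τ(x⋆x)^{1/2}` attached to a positive functional `τ`. -/
def norm2 {A : Type*} [Ring A] [StarRing A] [Algebra ℂ A] (τ : A →ₗ[ℂ] ℂ) (x : A) : ℝ :=
  Real.sqrt (τ (star x * x)).re

/-- Expressions for *-polynomials in the non-commuting variables `x₀, …, x_{k-1}` with coefficients
in `A`. (Complex scalars occur among the coefficients.) -/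
inductive StarPoly (A : Type*) (k : ℕ) where
  | coeff (a : A) : StarPoly A k
  | var (i : Fin k) : StarPoly A k
  | add (p q : StarPoly A k) : StarPoly A k
  | mul (p q : StarPoly A k) : StarPoly A k
  | star (p : StarPoly A k) : StarPoly A k

/-- The value of a *-polynomial at a tuple of elements. -/
def StarPoly.eval {A : Type*} [Ring A] [StarRing A] {k : ℕ} (a : Fin k → A) : StarPoly A k → A
  | .coeff c => c
  | .var i => a i
  | .add p q => p.eval a + q.eval a
  | .mul p q => p.eval a * q.eval a
  | .star p => Star.star (p.eval a)

/-- Countable quantifier-free saturation of `(A, τ)`: a countable system of conditions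
`‖pₙ(x̄)‖₂ = rₙ` has an exact solution in the operator unit ball if and only if it is approximately
satisfiable there. -/
def CountablyQFSaturated (A : Type*) [NormedRing A] [StarRing A] [Algebra ℂ A]
    (τ : A →ₗ[ℂ] ℂ) : Prop :=
  ∀ (k : ℕ) (p : ℕ → StarPoly A k) (r : ℕ → ℝ), (∀ n, 0 ≤ r n) →
    ((∃ a : Fin k → A, (∀ i, ‖a i‖ ≤ 1) ∧ ∀ n, norm2 τ ((p n).eval a) = r n) ↔
      ∀ n : ℕ, 1 ≤ n → ∃ a : Fin k → A, (∀ i, ‖a i‖ ≤ 1) ∧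
        ∀ j < n, |norm2 τ ((p j).eval a) - r j| < 1 / (n : ℝ))

/-- Type II₁: a nonzero finite algebra (every isometry is a unitary) without nonzero abelian
projections. -/
structure IsTypeIIOne (A : Type*) [Ring A] [StarRing A] : Prop where
  nontrivial : Nontrivial A
  finite : ∀ v : A, star v * v = 1 → v * star v = 1
  no_abelian : ∀ p : A, IsStarProjection p →
    (∀ x y : A, (p * x * p) * (p * y * p) = (p * y * p) * (p * x * p)) → p = 0

/-- A set is separable for the 2-norm. -/
def IsNorm2Separable {A : Type*} [Ring A] [StarRing A] [Algebra ℂ A] (τ : A →ₗ[ℂ] ℂ)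
    (S : Set A) : Prop :=
  ∃ D : Set A, D ⊆ S ∧ D.Countable ∧ ∀ x ∈ S, ∀ ε > 0, ∃ d ∈ D, norm2 τ (x - d) < ε

end Algebraic

/-! ### Tracial von Neumann algebras -/

/-- The von Neumann algebra generated by a set of operators: the double commutant of the set
together with its adjoints. -/
def generated {H : Type*} [NormedAddCommGroup H] [InnerProductSpace ℂ H] [CompleteSpace H]
    (S : Set (H →L[ℂ] H)) : VonNeumannAlgebra H where
  toStarSubalgebra := StarSubalgebra.centralizer ℂ (StarSubalgebra.centralizer ℂ S : Set (H →L[ℂ] H))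
  centralizer_centralizer' := by
    simp

/-- A von Neumann algebra acting on `H` with a faithful normal tracial state. Normality is
σ-weak continuity. -/
structure TracialVNA (H : Type*) [NormedAddCommGroup H] [InnerProductSpace ℂ H]
    [CompleteSpace H] where
  /-- The underlying von Neumann algebra. -/
  alg : VonNeumannAlgebra H
  /-- The trace. -/
  tr : alg.toStarSubalgebra →ₗ[ℂ] ℂ
  tr_one : tr 1 = 1
  tr_nonneg : ∀ x, 0 ≤ tr (star x * x)
  tr_faithful : ∀ x, tr (star x * x) = 0 → x = 0
  tr_comm : ∀ x y, tr (x * y) = tr (y * x)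
  tr_normal : ∃ ξ η : ℕ → H, Summable (fun n => ‖ξ n‖ ^ 2) ∧ Summable (fun n => ‖η n‖ ^ 2) ∧
    ∀ x : alg.toStarSubalgebra, HasSum (fun n => inner ℂ (ξ n) ((x : H →L[ℂ] H) (η n))) (tr x)

/-- The elements of a tracial von Neumann algebra. -/
abbrev TracialVNA.Elem {H : Type*} [NormedAddCommGroup H] [InnerProductSpace ℂ H]
    [CompleteSpace H] (N : TracialVNA H) : Type _ := N.alg.toStarSubalgebra

/-! ### Tensor products -/

section Tensor
open ContinuousLinearMap

variable {K H : Type*} [NormedAddCommGroup K] [InnerProductSpace ℂ K]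
  [NormedAddCommGroup H] [InnerProductSpace ℂ H]

/-- The Hilbert space tensor product. -/
abbrev HTensor (K H : Type*) [NormedAddCommGroup K] [InnerProductSpace ℂ K]
    [NormedAddCommGroup H] [InnerProductSpace ℂ H] : Type _ :=
  UniformSpace.Completion (K ⊗[ℂ] H)

/-- The operator `a ⊗ b` on the Hilbert space tensor product. -/
def opTensor (a : K →L[ℂ] K) (b : H →L[ℂ] H) : HTensor K H →L[ℂ] HTensor K H :=
  (TensorProduct.mapL a b).completion

theorem opTensor_coe (a : K →L[ℂ] K) (b : H →L[ℂ] H) (v : K ⊗[ℂ] H) :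
    opTensor a b (v : HTensor K H) = ((TensorProduct.mapL a b v : K ⊗[ℂ] H) : HTensor K H) := by
  simp [opTensor]

theorem opTensor_mul (a a' : K →L[ℂ] K) (b b' : H →L[ℂ] H) :
    opTensor a b * opTensor a' b' = opTensor (a * a') (b * b') := by
  ext v
  induction v using UniformSpace.Completion.induction_on with
  | hp => exact isClosed_eq (by fun_prop) (by fun_prop)
  | ih v =>
    change opTensor a b (opTensor a' b' (v : HTensor K H)) = _
    rw [opTensor_coe, opTensor_coe, opTensor_coe, TensorProduct.mapL_mul]
    rfl

/-- The operator `h ↦ ζ ⊗ h`. -/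
def leftInsert (ζ : K) : H →L[ℂ] HTensor K H :=
  UniformSpace.Completion.toComplL.comp (TensorProduct.mkL ℂ K H ζ)

theorem opTensor_one_leftInsert (ζ : K) (y : H →L[ℂ] H) :
    opTensor 1 y ∘L leftInsert ζ = leftInsert ζ ∘L y := by
  ext h
  simp [leftInsert, opTensor_coe]

variable [CompleteSpace K] [CompleteSpace H]

/-- The von Neumann algebra tensor product: the von Neumann algebra generated by the operators
`a ⊗ b` with `a ∈ A` and `b ∈ P`. -/
def vnTensor (A : VonNeumannAlgebra K) (P : VonNeumannAlgebra H) :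
    VonNeumannAlgebra (HTensor K H) :=
  generated {T | ∃ a ∈ A, ∃ b ∈ P, T = opTensor a b}

theorem inner_mapL (a : K →L[ℂ] K) (b : H →L[ℂ] H) (v w : K ⊗[ℂ] H) :
    inner ℂ (TensorProduct.mapL (star a) (star b) v) w = inner ℂ v (TensorProduct.mapL a b w) := by
  induction v using TensorProduct.induction_on with
  | zero => simp
  | add x y hx hy => simp only [map_add, inner_add_left, hx, hy]
  | tmul x y =>
    induction w using TensorProduct.induction_on with
    | zero => simp
    | add x y hx hy => simp only [map_add, inner_add_right, hx, hy]
    | tmul x y => simp [star_eq_adjoint, adjoint_inner_left]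

theorem star_opTensor (a : K →L[ℂ] K) (b : H →L[ℂ] H) :
    star (opTensor a b) = opTensor (star a) (star b) := by
  rw [star_eq_adjoint]
  symm
  rw [eq_adjoint_iff]
  intro v w
  induction v, w using UniformSpace.Completion.induction_on₂ with
  | hp => exact isClosed_eq (by fun_prop) (by fun_prop)
  | ih v w => simp only [opTensor_coe, UniformSpace.Completion.inner_coe, inner_mapL]

theorem opTensor_mem_centralizer {A : VonNeumannAlgebra K} {P : VonNeumannAlgebra H}
    {y : H →L[ℂ] H} (hy : y ∈ P.commutant) {T : HTensor K H →L[ℂ] HTensor K H}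
    (hT : T ∈ vnTensor A P) : opTensor 1 y * T = T * opTensor 1 y := by
  change T ∈ StarSubalgebra.centralizer ℂ _ at hT
  rw [StarSubalgebra.mem_centralizer_iff] at hT
  refine (hT _ ?_).1
  change _ ∈ StarSubalgebra.centralizer ℂ _
  rw [StarSubalgebra.mem_centralizer_iff]
  rintro _ ⟨a, ha, b, hb, rfl⟩
  rw [VonNeumannAlgebra.mem_commutant_iff] at hy
  simp only [star_opTensor, opTensor_mul, mul_one, one_mul, hy _ hb, hy _ (star_mem hb), and_self]

/-- The slice map `T ↦ (⟨ζ, · ζ⟩ ⊗ id)(T)`, as an operator on `H`. -/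
def sliceOp (ζ : K) (T : HTensor K H →L[ℂ] HTensor K H) : H →L[ℂ] H :=
  (adjoint (leftInsert ζ)) ∘L T ∘L leftInsert ζ

theorem sliceOp_mem (ζ : K) {A : VonNeumannAlgebra K} {P : VonNeumannAlgebra H}
    {T : HTensor K H →L[ℂ] HTensor K H} (hT : T ∈ vnTensor A P) : sliceOp ζ T ∈ P := by
  rw [← VonNeumannAlgebra.commutant_commutant P, VonNeumannAlgebra.mem_commutant_iff]
  intro y hy
  have h1 := opTensor_mem_centralizer hy hT
  have h2 : adjoint (leftInsert ζ) ∘L opTensor (1 : K →L[ℂ] K) y = y ∘L adjoint (leftInsert ζ) := by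
    have := congrArg adjoint (opTensor_one_leftInsert ζ (star y))
    rw [adjoint_comp, adjoint_comp] at this
    rw [← star_eq_adjoint (opTensor _ _), star_opTensor, star_star, star_one] at this
    rw [this, ← star_eq_adjoint, star_star]
  change y ∘L (adjoint (leftInsert ζ) ∘L (T ∘L leftInsert ζ)) =
    (adjoint (leftInsert ζ) ∘L (T ∘L leftInsert ζ)) ∘L y
  rw [← comp_assoc, ← h2, comp_assoc, ← comp_assoc (opTensor _ _)]
  rw [show opTensor 1 y ∘L T = T ∘L opTensor 1 y from h1, comp_assoc, opTensor_one_leftInsert]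
  simp only [comp_assoc]

/-- The slice map from `A ⊗̄ P` to `P`. -/
def slice (ζ : K) (A : VonNeumannAlgebra K) (P : VonNeumannAlgebra H) :
    (vnTensor A P).toStarSubalgebra →ₗ[ℂ] P.toStarSubalgebra where
  toFun T := ⟨sliceOp ζ T, sliceOp_mem ζ T.2⟩
  map_add' S T := by
    ext h
    simp [sliceOp]
  map_smul' c T := by
    ext h
    simp [sliceOp]

end Tensor

/-! ### The algebra `L^∞(Ω, μ) ⊗̄ P` -/

section Linfty
open MeasureTheory

/-- A measure space is diffuse if its measure algebra has no atoms. -/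
def IsDiffuse {Ω : Type*} [MeasurableSpace Ω] (μ : Measure Ω) : Prop :=
  ∀ E : Set Ω, MeasurableSet E → 0 < μ E →
    ∃ F : Set Ω, MeasurableSet F ∧ F ⊆ E ∧ 0 < μ F ∧ μ F < μ E

/-- The operator on `L²(Ω, μ)` of multiplication by an element of `L^∞(Ω, μ)`. -/
def mulOp {Ω : Type*} [MeasurableSpace Ω] (μ : Measure Ω) (f : Lp ℂ ∞ μ) :
    Lp ℂ 2 μ →L[ℂ] Lp ℂ 2 μ :=
  (ContinuousLinearMap.mul ℂ ℂ).holderL μ ∞ 2 2 f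

/-- The von Neumann algebra `L^∞(Ω, μ)`, acting on `L²(Ω, μ)` by multiplication. -/
def Linfty {Ω : Type*} [MeasurableSpace Ω] (μ : Measure Ω) : VonNeumannAlgebra (Lp ℂ 2 μ) :=
  generated (Set.range (mulOp μ))

/-- The von Neumann algebra `L^∞(Ω, μ) ⊗̄ P`. -/
abbrev LinftyTensor {Ω : Type*} [MeasurableSpace Ω] (μ : Measure Ω) {H : Type*}
    [NormedAddCommGroup H] [InnerProductSpace ℂ H] [CompleteSpace H] (P : TracialVNA H) :
    Type _ :=
  (vnTensor (Linfty μ) P.alg).toStarSubalgebra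

/-- The trace `τ_μ ⊗ τ_P` on `L^∞(Ω, μ) ⊗̄ P`: the slice map by `τ_μ = ⟨1, · 1⟩ = ∫ · dμ`
followed by `τ_P`. -/
def tensorTrace {Ω : Type*} [MeasurableSpace Ω] (μ : Measure Ω) [IsProbabilityMeasure μ]
    {H : Type*} [NormedAddCommGroup H] [InnerProductSpace ℂ H] [CompleteSpace H]
    (P : TracialVNA H) : LinftyTensor μ P →ₗ[ℂ] ℂ :=
  P.tr ∘ₗ slice (Lp.const 2 μ (1 : ℂ)) (Linfty μ) P.alg
end Linfty

/-! ### Estimates for the 2-norm, needed for the ultraproduct -/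

section Trace
variable {H : Type*} [NormedAddCommGroup H] [InnerProductSpace ℂ H] [CompleteSpace H]
  (N : TracialVNA H)

instance : IsClosed (N.alg.toStarSubalgebra : Set (H →L[ℂ] H)) := by
  have h : (N.alg.toStarSubalgebra : Set (H →L[ℂ] H)) =
      Set.centralizer (Set.centralizer (N.alg : Set (H →L[ℂ] H))) := by simp
  rw [h]
  exact Set.isClosed_centralizer _

theorem exists_conjugate_sub_eq {A : Type*} [CStarAlgebra A] (x y : A) :
    ∃ z : A, (‖x‖ ^ 2) • (star y * y) - star y * (star x * x) * y = star z * z := by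
  let _ : PartialOrder A := CStarAlgebra.spectralOrder _
  have _ : StarOrderedRing A := CStarAlgebra.spectralOrderedRing _
  have h : star y * (star x * x) * y ≤ ‖star x * x‖ • (star y * y) :=
    CStarAlgebra.star_left_conjugate_le_norm_smul (hb := IsSelfAdjoint.star_mul_self x)
  rw [CStarRing.norm_star_mul_self, ← pow_two] at h
  exact CStarAlgebra.nonneg_iff_eq_star_mul_self.1 (sub_nonneg.2 h)

/-- The square of the 2-norm. -/
def TracialVNA.sq (x : N.Elem) : ℝ := (N.tr (star x * x)).re

theorem TracialVNA.sq_nonneg (x : N.Elem) : 0 ≤ N.sq x := (Complex.le_def.1 (N.tr_nonneg x)).1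

theorem TracialVNA.norm2_eq (x : N.Elem) : norm2 N.tr x = Real.sqrt (N.sq x) := rfl

theorem TracialVNA.sq_eq (x : N.Elem) : N.sq x = norm2 N.tr x ^ 2 := by
  rw [N.norm2_eq, Real.sq_sqrt (N.sq_nonneg x)]

theorem TracialVNA.sq_star (x : N.Elem) : N.sq (star x) = N.sq x := by
  simp [TracialVNA.sq, N.tr_comm x]

theorem TracialVNA.sq_add_le (x y : N.Elem) : N.sq (x + y) ≤ 2 * N.sq x + 2 * N.sq y := by
  have h := N.sq_nonneg (x - y)
  simp only [TracialVNA.sq, star_add, star_sub, add_mul, mul_add, sub_mul, mul_sub, map_add,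
    map_sub, Complex.add_re, Complex.sub_re] at *
  linarith

theorem TracialVNA.sq_mul_le (x y : N.Elem) : N.sq (x * y) ≤ ‖x‖ ^ 2 * N.sq y := by
  let _ : CStarAlgebra N.Elem := StarSubalgebra.cstarAlgebra N.alg.toStarSubalgebra
  obtain ⟨z, hz⟩ := exists_conjugate_sub_eq x y
  have h2 := N.sq_nonneg z
  rw [TracialVNA.sq, ← hz, map_sub] at h2
  have h3 : N.tr ((‖x‖ ^ 2) • (star y * y)) = ((‖x‖ ^ 2 : ℝ) : ℂ) * N.tr (star y * y) := by
    rw [← Complex.coe_smul, map_smul, smul_eq_mul]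
  rw [h3, Complex.sub_re, Complex.re_ofReal_mul] at h2
  simp only [TracialVNA.sq, star_mul]
  have e : star y * star x * (x * y) = star y * (star x * x) * y := by simp only [mul_assoc]
  rw [e]
  linarith

theorem TracialVNA.sq_mul_le' (x y : N.Elem) : N.sq (y * x) ≤ ‖x‖ ^ 2 * N.sq y := by
  rw [← N.sq_star, ← N.sq_star y, star_mul]
  have := N.sq_mul_le (star x) (star y)
  rwa [show ‖star x‖ = ‖x‖ from norm_star (x : H →L[ℂ] H)] at this

theorem TracialVNA.sq_one : N.sq 1 = 1 := by simp [TracialVNA.sq, N.tr_one]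

theorem TracialVNA.tr_star (x : N.Elem) : N.tr (star x) = star (N.tr x) := by
  have h1 := (Complex.le_def.1 (N.tr_nonneg (1 + x))).2
  have h2 := (Complex.le_def.1 (N.tr_nonneg (1 + Complex.I • x))).2
  have h3 := (Complex.le_def.1 (N.tr_nonneg x)).2
  simp only [star_add, star_one, add_mul, mul_add, one_mul, mul_one, map_add, N.tr_one, star_smul,
    map_smul, smul_mul_assoc, mul_smul_comm, smul_eq_mul] at h1 h2
  simp at h1 h2 h3
  apply Complex.ext
  · simp; linarith
  · simp; linarith

theorem TracialVNA.norm_tr_sq_le (x : N.Elem) : ‖N.tr x‖ ^ 2 ≤ N.sq x := by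
  have h := N.sq_nonneg (x - N.tr x • 1)
  simp only [TracialVNA.sq, star_sub, star_smul, star_one, sub_mul, mul_sub, smul_mul_assoc,
    mul_smul_comm, one_mul, mul_one, map_sub, map_smul, N.tr_one, N.tr_star, smul_eq_mul] at h
  simp only [Complex.star_def, Complex.sub_re, Complex.mul_re, Complex.conj_re,
    Complex.conj_im] at h
  rw [Complex.sq_norm, Complex.normSq_apply, TracialVNA.sq]
  linarith

theorem TracialVNA.norm_tr_le (x : N.Elem) : ‖N.tr x‖ ≤ ‖x‖ := by
  have h1 := N.norm_tr_sq_le x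
  have h2 := N.sq_mul_le x 1
  rw [mul_one, N.sq_one, mul_one] at h2
  exact (sq_le_sq₀ (norm_nonneg _) (norm_nonneg _)).1 (h1.trans h2)
end Trace

/-! ### Tracial ultraproducts -/

section Ultra
open Filter

variable {K : ℕ → Type*} [∀ n, NormedAddCommGroup (K n)] [∀ n, InnerProductSpace ℂ (K n)]
  [∀ n, CompleteSpace (K n)] (N : ∀ n, TracialVNA (K n)) (U : Ultrafilter ℕ)

/-- The *-algebra of norm-bounded sequences `(xₙ)` with `xₙ ∈ Nₙ`. -/
def boundedSeq : StarSubalgebra ℂ (∀ n, (N n).Elem) where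
  carrier := {x | ∃ C : ℝ, ∀ n, ‖x n‖ ≤ C}
  mul_mem' := by
    rintro x y ⟨C, hC⟩ ⟨D, hD⟩
    exact ⟨C * D, fun n => (norm_mul_le _ _).trans
      (mul_le_mul (hC n) (hD n) (norm_nonneg _) ((norm_nonneg _).trans (hC n)))⟩
  add_mem' := by
    rintro x y ⟨C, hC⟩ ⟨D, hD⟩
    exact ⟨C + D, fun n => (norm_add_le _ _).trans (add_le_add (hC n) (hD n))⟩
  algebraMap_mem' c := ⟨‖c‖, fun n => by
    change ‖algebraMap ℂ (K n →L[ℂ] K n) c‖ ≤ ‖c‖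
    rw [Algebra.algebraMap_eq_smul_one, norm_smul]
    exact mul_le_of_le_one_right (norm_nonneg _) ContinuousLinearMap.norm_id_le⟩
  star_mem' := by
    rintro x ⟨C, hC⟩
    exact ⟨C, fun n => (norm_star (x n : K n →L[ℂ] K n)).trans_le (hC n)⟩

theorem tendsto_norm2_iff (x : ∀ n, (N n).Elem) :
    Tendsto (fun n => norm2 (N n).tr (x n)) U (𝓝 0) ↔
      Tendsto (fun n => (N n).sq (x n)) U (𝓝 0) := by
  constructor
  · intro h
    simp only [TracialVNA.sq_eq]
    simpa using h.pow 2
  · intro h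
    simp only [TracialVNA.norm2_eq]
    simpa using h.sqrt

theorem tendsto_sq_of_le {C : ℝ} {x y : ∀ n, (N n).Elem}
    (h : ∀ n, (N n).sq (y n) ≤ C * (N n).sq (x n))
    (hx : Tendsto (fun n => (N n).sq (x n)) U (𝓝 0)) :
    Tendsto (fun n => (N n).sq (y n)) U (𝓝 0) :=
  squeeze_zero (fun n => (N n).sq_nonneg _) h (by simpa using hx.const_mul C)

/-- The ideal of the bounded sequences with `‖xₙ‖₂ → 0` along `U`. -/
def nullIdeal : Ideal (boundedSeq N) where
  carrier := {x | Tendsto (fun n => norm2 (N n).tr (x.1 n)) U (𝓝 0)}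
  add_mem' := by
    intro x y hx hy
    rw [Set.mem_ofPred_eq, tendsto_norm2_iff] at *
    refine squeeze_zero (fun n => (N n).sq_nonneg _) (fun n => (N n).sq_add_le _ _) ?_
    simpa using (hx.const_mul 2).add (hy.const_mul 2)
  zero_mem' := by
    simp [norm2]
  smul_mem' := by
    rintro ⟨c, C, hC⟩ x hx
    rw [Set.mem_ofPred_eq, tendsto_norm2_iff] at *
    refine tendsto_sq_of_le N U (C := C ^ 2) (fun n => ((N n).sq_mul_le _ _).trans ?_) hx
    exact mul_le_mul_of_nonneg_right (pow_le_pow_left₀ (norm_nonneg _) (hC n) 2)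
      ((N n).sq_nonneg _)

variable {N U} in
theorem mem_nullIdeal {x : boundedSeq N} :
    x ∈ nullIdeal N U ↔ Tendsto (fun n => norm2 (N n).tr (x.1 n)) U (𝓝 0) := Iff.rfl

instance : (nullIdeal N U).IsTwoSided where
  mul_mem_of_left := by
    rintro x ⟨c, C, hC⟩ hx
    rw [mem_nullIdeal, tendsto_norm2_iff] at *
    refine tendsto_sq_of_le N U (C := C ^ 2) (fun n => ((N n).sq_mul_le' _ _).trans ?_) hx
    exact mul_le_mul_of_nonneg_right (pow_le_pow_left₀ (norm_nonneg _) (hC n) 2)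
      ((N n).sq_nonneg _)

theorem star_mem_nullIdeal {x : boundedSeq N} (hx : x ∈ nullIdeal N U) :
    star x ∈ nullIdeal N U := by
  rw [mem_nullIdeal, tendsto_norm2_iff] at *
  refine hx.congr fun n => ?_
  exact ((N n).sq_star _).symm

/-- The tracial ultraproduct `∏^U Nₙ`. -/
abbrev Ultraproduct : Type _ := boundedSeq N ⧸ nullIdeal N U

instance : StarRing (Ultraproduct N U) where
  star := Quotient.map' star fun x y h => by
    rw [Submodule.quotientRel_def] at h ⊢
    have h' := star_mem_nullIdeal N U h
    rwa [star_sub] at h'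
  star_involutive := by
    rintro ⟨x⟩
    exact congrArg (Ideal.Quotient.mk (nullIdeal N U)) (star_star x)
  star_mul := by
    rintro ⟨x⟩ ⟨y⟩
    exact congrArg (Ideal.Quotient.mk (nullIdeal N U)) (star_mul x y)
  star_add := by
    rintro ⟨x⟩ ⟨y⟩
    exact congrArg (Ideal.Quotient.mk (nullIdeal N U)) (star_add x y)

instance : StarModule ℂ (Ultraproduct N U) where
  star_smul := by
    rintro c ⟨x⟩
    exact congrArg (Ideal.Quotient.mk (nullIdeal N U)) (star_smul c x)

theorem exists_tendsto_tr (x : boundedSeq N) :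
    ∃ l : ℂ, Tendsto (fun n => (N n).tr (x.1 n)) U (𝓝 l) := by
  obtain ⟨C, hC⟩ := x.2
  have hK : IsCompact (Metric.closedBall (0 : ℂ) C) := isCompact_closedBall _ _
  obtain ⟨l, -, hl⟩ := hK.ultrafilter_le_nhds (U.map fun n => (N n).tr (x.1 n)) (by
    rw [le_principal_iff]
    refine Filter.mem_map.2 (Filter.univ_mem' fun n => ?_)
    simpa using ((N n).norm_tr_le _).trans (hC n))
  exact ⟨l, hl⟩

/-- The functional `(xₙ) ↦ lim_{n → U} τₙ(xₙ)` on bounded sequences. -/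
def limTrace : boundedSeq N →ₗ[ℂ] ℂ where
  toFun x := limUnder (U : Filter ℕ) fun n => (N n).tr (x.1 n)
  map_add' x y := by
    refine Tendsto.limUnder_eq ?_
    simpa using (tendsto_nhds_limUnder (exists_tendsto_tr N U x)).add
      (tendsto_nhds_limUnder (exists_tendsto_tr N U y))
  map_smul' c x := by
    refine Tendsto.limUnder_eq ?_
    simpa using (tendsto_nhds_limUnder (exists_tendsto_tr N U x)).const_mul c

theorem limTrace_eq_zero {x : boundedSeq N} (hx : x ∈ nullIdeal N U) : limTrace N U x = 0 := by
  refine Tendsto.limUnder_eq (squeeze_zero_norm (fun n => ?_) hx)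
  exact Real.le_sqrt_of_sq_le ((N n).norm_tr_sq_le _)

/-- The trace `τ_U([(xₙ)]) = lim_{n → U} τₙ(xₙ)` on the ultraproduct. -/
def ultraTrace : Ultraproduct N U →ₗ[ℂ] ℂ where
  toFun q := Quotient.liftOn' q (limTrace N U) fun x y h => by
    rw [Submodule.quotientRel_def] at h
    rw [← sub_eq_zero, ← map_sub]
    exact limTrace_eq_zero N U h
  map_add' := by
    rintro ⟨x⟩ ⟨y⟩
    exact (limTrace N U).map_add x y
  map_smul' := by
    rintro c ⟨x⟩
    exact (limTrace N U).map_smul c x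

theorem ultraTrace_mk (x : boundedSeq N) :
    ultraTrace N U (Ideal.Quotient.mk _ x) = limUnder (U : Filter ℕ) fun n => (N n).tr (x.1 n) :=
  rfl
end Ultra

end TracialVN

end

/-!
The obstruction lives in systems of equations `x⋆x = 1`, `x aₙ = bₙ x` (`n ∈ ℕ`) in one unknown
(`HasUnsolvableSystem`): in `M = L^∞(Ω, μ) ⊗̄ P` one such system has no solution although all its
finite subsystems do, whereas a tracial ultraproduct, or the relative commutant of a separable
subset of one, never admits such a system.

**The system in `M`.** A type II₁ algebra `P` contains commuting copies of the `2 × 2` matrices,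
hence self-adjoint unitaries `uₙ, Vₙ` such that `Vₙ` anticommutes with `uₙ` and commutes with the
other `uₘ` (`exists_spins`). For this, a maximal orthogonal family of partial isometries of square
zero sums to some `v` with `v² = 0` and `v⋆v + vv⋆ = 1` (`exists_halving`), and the commutant of
`v, v⋆` again has no abelian projections (`noAbelian_relCommutant`), so that the construction can
be iterated. Since `μ` is diffuse, there is a sequence of measurable sets `Eₙ` from which
partitions of `Ω` of arbitrarily small mesh can be selected (`IsDiffuse.exists_seq`). Put
`eₙ = 1_{Eₙ} ⊗ 1` and consider `x (1 ⊗ uₙ) = (1 - 2eₙ)(1 ⊗ uₙ) x`. The product of the unitaries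
`(1 - eₙ) + eₙ (1 ⊗ Vₙ)` over `n < N` solves the first `N` equations (`exists_finite_intertwiner`).
If `x` solves all of them, so does `y = (1_B ⊗ 1) x` for every measurable `B`. Let `E` be the slice
map `M → P` that integrates over `Ω`. Over a partition by sets `Eₙ`, the elements `E(eₙ y)`
anticommute with their own `uₙ` and commute with the `uₖ` of the other parts, so they are
orthogonal for the trace, while `‖E(eₙ y)‖ ≤ μ(Eₙ) ‖y‖`. Hence `‖E(y)‖₂² ≤ ∑ μ(Eₙ)² ‖y‖²` is as
small as we please, `E((1_B ⊗ 1) x) = 0` for all `B`, and `x = 0` (`map_eq_zero_of_intertwines`,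
`eq_zero_of_expectation_cutoff`), contradicting `x⋆x = 1`. As the trace of `M` is faithful, the
equations are conditions `‖p(x)‖₂ = 0`, and countable saturation fails.

**Solvability in ultraproducts.** If `X⋆X = 1` in `∏^U Nₙ` and `y` represents `X`, then
`2y(1 + y⋆y)⁻¹` is a sequence of contractions that represents `X` (`exists_contractive_lift`). This
uniform norm bound lets solutions of the finite subsystems be combined along `U` by a diagonal
argument (`exists_diagonal`, `exists_solution_of_finite`), also when commutation with countably
many given elements is required; commutation with a 2-norm dense subset of `S` implies commutation
with `S` (`commute_of_dense`). A *-isomorphism would transport the system of `M`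
(`HasUnsolvableSystem.map`).
-/

set_option linter.unusedSectionVars false

noncomputable section

namespace TracialVN

/-! ### Partial isometries in algebras without abelian projections -/

section NilpotentPartialIsometries
open ContinuousLinearMap

variable {H : Type*} [NormedAddCommGroup H] [InnerProductSpace ℂ H] [CompleteSpace H]

theorem mem_iff_commute {A : VonNeumannAlgebra H} {x : H →L[ℂ] H} :
    x ∈ A ↔ ∀ y ∈ A.commutant, y * x = x * y := by
  rw [← VonNeumannAlgebra.mem_commutant_iff, VonNeumannAlgebra.commutant_commutant]

theorem commutant_commute {A : VonNeumannAlgebra H} {x y : H →L[ℂ] H} (hx : x ∈ A)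
    (hy : y ∈ A.commutant) : y * x = x * y :=
  mem_iff_commute.1 hx y hy

theorem posPart_mem {A : VonNeumannAlgebra H} {a : H →L[ℂ] H} (ha : a ∈ A) : a⁺ ∈ A := by
  rw [mem_iff_commute]
  intro y hy
  rw [CFC.posPart_def]
  exact (Commute.cfcₙ_real (show Commute a y from (commutant_commute ha hy).symm) _).symm

/-- The projection onto the closure of the range of an operator. -/
def rangeProj (T : H →L[ℂ] H) : H →L[ℂ] H :=
  (LinearMap.range (T : H →ₗ[ℂ] H)).topologicalClosure.starProjection

theorem isStarProjection_rangeProj (T : H →L[ℂ] H) : IsStarProjection (rangeProj T) :=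
  isStarProjection_starProjection

theorem rangeProj_mul (T : H →L[ℂ] H) : rangeProj T * T = T := by
  ext x
  change rangeProj T (T x) = T x
  rw [rangeProj, Submodule.starProjection_eq_self_iff]
  exact Submodule.le_topologicalClosure _ ⟨x, rfl⟩

theorem mul_rangeProj_eq_zero {S T : H →L[ℂ] H} (h : S * T = 0) : S * rangeProj T = 0 := by
  ext x
  change S (rangeProj T x) = 0
  have h1 : (LinearMap.range (T : H →ₗ[ℂ] H)).topologicalClosure ≤
      LinearMap.ker (S : H →ₗ[ℂ] H) := by
    refine Submodule.topologicalClosure_minimal _ ?_ S.isClosed_ker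
    rintro _ ⟨y, rfl⟩
    exact congrArg (fun f : H →L[ℂ] H => f y) h
  exact h1 (Submodule.starProjection_apply_mem _ x)

theorem rangeProj_mem {A : VonNeumannAlgebra H} {T : H →L[ℂ] H} (hT : T ∈ A) :
    rangeProj T ∈ A := by
  have hp := isStarProjection_rangeProj T
  have key : ∀ y ∈ A.commutant, y * rangeProj T = rangeProj T * y * rangeProj T := by
    intro y hy
    have h1 : ((1 - rangeProj T) * y) * T = 0 := by
      rw [mul_assoc, commutant_commute hT hy, ← mul_assoc, sub_mul, one_mul, rangeProj_mul,
        sub_self, zero_mul]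
    have h2 := mul_rangeProj_eq_zero h1
    rwa [sub_mul, sub_mul, one_mul, sub_eq_zero] at h2
  rw [mem_iff_commute]
  intro y hy
  rw [key y hy]
  have := congrArg star (key (star y) (star_mem hy))
  simp only [star_mul, star_star, hp.isSelfAdjoint.star_eq] at this
  rw [this, ← mul_assoc, mul_assoc (_ * _), hp.isIdempotentElem.eq]

/-- An algebra of operators without nonzero abelian projections. -/
def NoAbelian (A : VonNeumannAlgebra H) : Prop :=
  ∀ p ∈ A, IsStarProjection p →
    (∀ x ∈ A, ∀ y ∈ A, (p * x * p) * (p * y * p) = (p * y * p) * (p * x * p)) → p = 0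

theorem TracialVNA.exists_star_mul_self_eq (P : TracialVNA H) {x : P.Elem}
    (hx : 0 ≤ (x : H →L[ℂ] H)) : ∃ s : P.Elem, star s * s = x := by
  have hsP : CFC.sqrt (x : H →L[ℂ] H) ∈ P.alg := by
    rw [mem_iff_commute]
    intro y hy
    rw [CFC.sqrt]
    exact (Commute.cfcₙ_nnreal (show Commute (x : H →L[ℂ] H) y from
      (commutant_commute x.2 hy).symm) _).symm
  refine ⟨⟨_, hsP⟩, Subtype.ext ?_⟩
  change star (CFC.sqrt (x : H →L[ℂ] H)) * CFC.sqrt (x : H →L[ℂ] H) = x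
  rw [(CFC.sqrt_nonneg (x : H →L[ℂ] H)).isSelfAdjoint.star_eq]
  exact CFC.sqrt_mul_sqrt_self _ hx

theorem TracialVNA.eq_zero_of_nonneg (P : TracialVNA H) {x : P.Elem}
    (hx : 0 ≤ (x : H →L[ℂ] H)) (h : (P.tr x).re ≤ 0) : x = 0 := by
  obtain ⟨s, rfl⟩ := P.exists_star_mul_self_eq hx
  have h0 := Complex.le_def.1 (P.tr_nonneg s)
  rw [P.tr_faithful s (Complex.ext (le_antisymm h h0.1) h0.2.symm), mul_zero]

/-- The trace of `q[a, b]` vanishes when `q` commutes with `a`, so that a scalar multiple of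
`q[a, b]` can be positive only if it is zero. -/
theorem mul_commutator_eq_zero (P : TracialVNA H) {a b q : H →L[ℂ] H} (ha : a ∈ P.alg)
    (hb : b ∈ P.alg) (hq : q ∈ P.alg) (hqa : q * a = a * q) {c : ℂ}
    (hpos : 0 ≤ q * (c • (a * b - b * a))) : q * (c • (a * b - b * a)) = 0 := by
  have hm : q * (c • (a * b - b * a)) ∈ P.alg :=
    mul_mem hq (P.alg.toStarSubalgebra.smul_mem (sub_mem (mul_mem ha hb) (mul_mem hb ha)) _)
  refine congrArg Subtype.val (P.eq_zero_of_nonneg (x := ⟨_, hm⟩) hpos (le_of_eq ?_))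
  have e : (⟨_, hm⟩ : P.Elem) =
      c • (⟨q, hq⟩ * ⟨a, ha⟩ * ⟨b, hb⟩ - ⟨q, hq⟩ * ⟨b, hb⟩ * ⟨a, ha⟩) := by
    apply Subtype.ext
    change q * (c • (a * b - b * a)) = c • (q * a * b - q * b * a)
    rw [mul_smul_comm, mul_sub, mul_assoc, mul_assoc]
  have e2 : P.tr (⟨q, hq⟩ * ⟨a, ha⟩ * ⟨b, hb⟩) = P.tr (⟨q, hq⟩ * ⟨b, hb⟩ * ⟨a, ha⟩) := by
    rw [P.tr_comm (⟨q, hq⟩ * ⟨b, hb⟩), ← mul_assoc,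
      show (⟨q, hq⟩ * ⟨a, ha⟩ : P.Elem) = ⟨a, ha⟩ * ⟨q, hq⟩ from Subtype.ext hqa]
  rw [e, map_smul, map_sub, e2, sub_self, smul_zero, Complex.zero_re]

theorem mul_rangeProj_absorb {r T : H →L[ℂ] H} (h : r * T = T) :
    r * rangeProj T = rangeProj T := by
  have : (1 - r) * T = 0 := by rw [sub_mul, h, one_mul, sub_self]
  have := mul_rangeProj_eq_zero this
  rw [sub_mul, one_mul, sub_eq_zero] at this
  exact this.symm

theorem posPart_absorb {r h : H →L[ℂ] H} (hh : IsSelfAdjoint h)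
    (hrh : r * h = h) : r * h⁺ = h⁺ := by
  have h1 : (1 - r) * (h⁺ * h⁺) = 0 := by
    have : h * h⁺ = h⁺ * h⁺ := by
      nth_rewrite 1 [← CFC.posPart_sub_negPart h hh]
      rw [sub_mul, CFC.negPart_mul_posPart, sub_zero]
    rw [← this, ← mul_assoc, sub_mul, one_mul, hrh, sub_self, zero_mul]
  have hs : star (h⁺) = h⁺ := (CFC.posPart_nonneg h).isSelfAdjoint.star_eq
  have h2 : ((1 - r) * h⁺) * star ((1 - r) * h⁺) = 0 := by
    rw [star_mul, hs, ← mul_assoc, mul_assoc (1 - r), h1, zero_mul]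
  have h3 := CStarRing.mul_star_self_eq_zero_iff _ |>.1 h2
  rw [sub_mul, one_mul, sub_eq_zero] at h3
  exact h3.symm

theorem rangeProj_posPart_mul {h : H →L[ℂ] H} (hh : IsSelfAdjoint h) :
    rangeProj (h⁺) * h = h⁺ := by
  have hs' : star (h⁻) = h⁻ := (CFC.negPart_nonneg h).isSelfAdjoint.star_eq
  have h1 : h⁻ * rangeProj (h⁺) = 0 := mul_rangeProj_eq_zero (CFC.negPart_mul_posPart h)
  have h2 := congrArg star h1
  rw [star_mul, hs', (isStarProjection_rangeProj _).isSelfAdjoint.star_eq, star_zero] at h2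
  nth_rewrite 2 [← CFC.posPart_sub_negPart h hh]
  rw [mul_sub, rangeProj_mul, h2, sub_zero]

/-- Two noncommuting self-adjoint elements of the corner `rAr` force a projection of `rAr` which
does not commute with the first of them. -/
theorem exists_projection_not_commute (P : TracialVNA H) {A : VonNeumannAlgebra H}
    (hA : ∀ x ∈ A, x ∈ P.alg) {r a b : H →L[ℂ] H}
    (ha : a ∈ A) (hb : b ∈ A) (has : IsSelfAdjoint a) (hbs : IsSelfAdjoint b)
    (hra : r * a = a) (hrb : r * b = b) (hab : a * b ≠ b * a) :
    ∃ q ∈ A, IsStarProjection q ∧ r * q = q ∧ q * a ≠ a * q := by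
  by_contra! hcon
  have main : ∀ c : ℂ, star c = -c → (c • (a * b - b * a))⁺ = 0 := by
    intro c hc
    have hs : IsSelfAdjoint (c • (a * b - b * a)) := by
      rw [IsSelfAdjoint, star_smul, star_sub, star_mul, star_mul, has.star_eq, hbs.star_eq, hc,
        neg_smul, ← smul_neg, neg_sub]
    have hm : c • (a * b - b * a) ∈ A :=
      A.toStarSubalgebra.smul_mem (sub_mem (mul_mem ha hb) (mul_mem hb ha)) _
    have hr : r * (c • (a * b - b * a)) = c • (a * b - b * a) := by
      rw [mul_smul_comm, mul_sub, ← mul_assoc, ← mul_assoc, hra, hrb]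
    have hqA := rangeProj_mem (posPart_mem hm)
    have h1 := hcon _ hqA (isStarProjection_rangeProj _) (mul_rangeProj_absorb
      (posPart_absorb hs hr))
    rw [← rangeProj_posPart_mul hs]
    refine mul_commutator_eq_zero P (hA _ ha) (hA _ hb) (hA _ hqA) h1 ?_
    rw [rangeProj_posPart_mul hs]
    exact CFC.posPart_nonneg _
  have h1 := main Complex.I (by simp)
  have h2 := main (-Complex.I) (by simp)
  rw [neg_smul, CFC.posPart_neg] at h2
  have hs : IsSelfAdjoint (Complex.I • (a * b - b * a)) := by
    rw [IsSelfAdjoint, star_smul, star_sub, star_mul, star_mul, has.star_eq, hbs.star_eq]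
    simp only [Complex.star_def, Complex.conj_I, neg_smul, ← smul_neg, neg_sub]
  have h3 := CFC.posPart_sub_negPart _ hs
  rw [h1, h2, sub_zero] at h3
  exact hab (sub_eq_zero.1 ((smul_eq_zero.1 h3.symm).resolve_left Complex.I_ne_zero))

/-- A nonzero corner `rAr` of an algebra without abelian projections contains a nonzero partial
isometry `v` with `v² = 0`. -/
theorem exists_nilpotent_partialIsometry (P : TracialVNA H) {A : VonNeumannAlgebra H}
    (hA : ∀ x ∈ A, x ∈ P.alg) (hN : NoAbelian A) {r : H →L[ℂ] H} (hrA : r ∈ A)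
    (hr : IsStarProjection r) (hr0 : r ≠ 0) :
    ∃ v ∈ A, v ≠ 0 ∧ v * v = 0 ∧ v * star v * v = v ∧ r * v = v ∧ v * r = v := by
  have hrr : r * r = r := hr.isIdempotentElem
  have hrs : star r = r := hr.isSelfAdjoint
  -- noncommuting self-adjoint elements of the corner
  obtain ⟨a, b, ha, hb, has, hbs, hra, hrb, hab⟩ : ∃ a b : H →L[ℂ] H, a ∈ A ∧ b ∈ A ∧
      IsSelfAdjoint a ∧ IsSelfAdjoint b ∧ r * a = a ∧ r * b = b ∧ a * b ≠ b * a := by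
    by_contra! hcon
    refine hr0 (hN r hrA hr fun x hx y hy => ?_)
    have corner : ∀ z ∈ A, ∃ z₁ z₂ : H →L[ℂ] H, z₁ ∈ A ∧ z₂ ∈ A ∧ IsSelfAdjoint z₁ ∧
        IsSelfAdjoint z₂ ∧ r * z₁ = z₁ ∧ r * z₂ = z₂ ∧ r * z * r = z₁ + Complex.I • z₂ := by
      intro z hz
      have hm : r * z * r ∈ A := mul_mem (mul_mem hrA hz) hrA
      have hms := star_mem hm
      have e1 : r * (r * z * r) = r * z * r := by rw [← mul_assoc, ← mul_assoc, hrr]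
      have e2 : r * star (r * z * r) = star (r * z * r) := by
        simp only [star_mul, hrs, ← mul_assoc, hrr]
      refine ⟨realPart (r * z * r), imaginaryPart (r * z * r), ?_, ?_, (realPart _).2,
        (imaginaryPart _).2, ?_, ?_, (realPart_add_I_smul_imaginaryPart _).symm⟩
      · rw [realPart_apply_coe]
        exact A.toStarSubalgebra.smul_mem (add_mem hm hms) (2⁻¹ : ℝ)
      · rw [imaginaryPart_apply_coe]
        exact A.toStarSubalgebra.smul_mem (A.toStarSubalgebra.smul_mem (sub_mem hm hms) (2⁻¹ : ℝ)) _
      · rw [realPart_apply_coe, mul_smul_comm, mul_add, e1, e2]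
      · rw [imaginaryPart_apply_coe, mul_smul_comm, mul_smul_comm, mul_sub, e1, e2]
    obtain ⟨x₁, x₂, hx₁, hx₂, hs₁, hs₂, hr₁, hr₂, ex⟩ := corner x hx
    obtain ⟨y₁, y₂, hy₁, hy₂, ht₁, ht₂, hq₁, hq₂, ey⟩ := corner y hy
    rw [ex, ey]
    simp only [add_mul, mul_add, smul_mul_assoc, mul_smul_comm,
      hcon x₁ y₁ hx₁ hy₁ hs₁ ht₁ hr₁ hq₁, hcon x₁ y₂ hx₁ hy₂ hs₁ ht₂ hr₁ hq₂,
      hcon x₂ y₁ hx₂ hy₁ hs₂ ht₁ hr₂ hq₁, hcon x₂ y₂ hx₂ hy₂ hs₂ ht₂ hr₂ hq₂, smul_add]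
    abel
  obtain ⟨q, hqA, hq, hrq, hqa⟩ := exists_projection_not_commute P hA ha hb has hbs hra hrb hab
  have hqq : q * q = q := hq.isIdempotentElem
  have hqs : star q = q := hq.isSelfAdjoint
  have hqr : q * r = q := by simpa [hqs, hrs] using congrArg star hrq
  set h : H →L[ℂ] H := q * a * (1 - q) + (1 - q) * a * q with hh
  have hhs : IsSelfAdjoint h := by
    rw [IsSelfAdjoint, hh]
    simp only [star_add, star_mul, star_sub, star_one, hqs, has.star_eq, ← mul_assoc]
    exact add_comm _ _
  have hhA : h ∈ A := add_mem (mul_mem (mul_mem hqA ha) (sub_mem (one_mem _) hqA))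
    (mul_mem (mul_mem (sub_mem (one_mem _) hqA) ha) hqA)
  have hrh : r * h = h := by
    have h1 : r * (1 - q) * a = (1 - q) * a := by
      rw [mul_sub, mul_one, hrq, sub_mul, hra, sub_mul, one_mul]
    rw [hh, mul_add, ← mul_assoc, ← mul_assoc, hrq, ← mul_assoc, ← mul_assoc, h1]
  -- `w = 2q - 1` conjugates `h` to `-h`, hence `h⁺` to `h⁻`
  set w : H →L[ℂ] H := q + q - 1 with hw
  have hww : w * w = 1 := by
    rw [hw]; simp only [sub_mul, mul_sub, add_mul, mul_add, hqq, one_mul, mul_one]; abel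
  have hws : star w = w := by rw [hw]; simp [hqs]
  have hwhw : w * h * w = -h := by
    have e1 : w * q = q := by rw [hw, sub_mul, add_mul, hqq, one_mul, add_sub_cancel_right]
    have e2 : q * w = q := by rw [hw, mul_sub, mul_add, hqq, mul_one, add_sub_cancel_right]
    have e3 : w * (1 - q) = -(1 - q) := by rw [mul_sub, e1, hw, mul_one]; abel
    have e4 : (1 - q) * w = -(1 - q) := by rw [sub_mul, e2, hw, one_mul]; abel
    rw [hh, mul_add, add_mul]
    simp only [← mul_assoc, e1, e3]
    simp only [mul_assoc, e2, e4]
    simp only [neg_mul, mul_neg, neg_add]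
  have hconj : w * h⁺ * w = h⁻ := by
    have hu := CFC.posPart_negPart_unique (a := h) (b := w * h⁻ * w) (c := w * h⁺ * w) ?_ ?_ ?_ ?_
    · exact hu.2.symm
    · rw [← sub_mul, ← mul_sub, ← neg_sub, CFC.posPart_sub_negPart h hhs, mul_neg, neg_mul, hwhw,
        neg_neg]
    · calc w * h⁻ * w * (w * h⁺ * w) = w * (h⁻ * (w * w) * h⁺) * w := by simp only [mul_assoc]
        _ = 0 := by rw [hww, mul_one, CFC.negPart_mul_posPart, mul_zero, zero_mul]
    · simpa [hws] using star_left_conjugate_nonneg (CFC.negPart_nonneg h) w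
    · simpa [hws] using star_left_conjugate_nonneg (CFC.posPart_nonneg h) w
  set e : H →L[ℂ] H := rangeProj (h⁺) with he
  have hes : star e = e := (isStarProjection_rangeProj _).isSelfAdjoint
  have hee : e * e = e := (isStarProjection_rangeProj _).isIdempotentElem
  have hps : star (h⁺) = h⁺ := (CFC.posPart_nonneg h).isSelfAdjoint.star_eq
  have heA : e ∈ A := rangeProj_mem (posPart_mem hhA)
  have hre : r * e = e := mul_rangeProj_absorb (posPart_absorb hhs hrh)
  have her : e * r = e := by simpa [hes, hrs] using congrArg star hre
  have hewe : e * w * e = 0 := by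
    have h1 : h⁺ * w * h⁺ = 0 := by
      calc h⁺ * w * h⁺ = h⁺ * (w * h⁺ * w) * w := by
            simp only [mul_assoc, hww, mul_one]
        _ = 0 := by rw [hconj, CFC.posPart_mul_negPart, zero_mul]
    have h2 := congrArg star (mul_rangeProj_eq_zero h1)
    rw [← he, star_mul, star_mul, hes, hps, hws, star_zero, ← mul_assoc] at h2
    exact mul_rangeProj_eq_zero h2
  have heqe : e * q * e + e * q * e = e := by
    rw [hw, mul_sub, mul_add, sub_mul, add_mul, mul_one, hee, sub_eq_zero] at hewe
    exact hewe
  have heqe' : e * q * e = (2⁻¹ : ℂ) • e := by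
    calc e * q * e = (2⁻¹ : ℂ) • (e * q * e + e * q * e) := by
          rw [← two_smul ℂ, smul_smul]; norm_num
      _ = _ := by rw [heqe]
  have heqe'' : e * (1 - q) * e = (2⁻¹ : ℂ) • e := by
    rw [mul_sub, sub_mul, mul_one, hee, ← heqe']
    exact sub_eq_of_eq_add heqe.symm
  have hq1 : (1 - q) * (1 - q) = 1 - q := by
    simp only [sub_mul, mul_sub, one_mul, mul_one, hqq, sub_self, sub_zero]
  have hq2 : (1 - q) * q = 0 := by rw [sub_mul, one_mul, hqq, sub_self]
  have hq3 : q * (1 - q) = 0 := by rw [mul_sub, mul_one, hqq, sub_self]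
  have hst : star (q * e * (1 - q)) = (1 - q) * e * q := by
    simp only [star_mul, star_sub, star_one, hqs, hes, mul_assoc]
  have hqrq : r * (1 - q) = (1 - q) * r := by rw [mul_sub, sub_mul, mul_one, one_mul, hrq, hqr]
  refine ⟨(2 : ℂ) • (q * e * (1 - q)), A.toStarSubalgebra.smul_mem
    (mul_mem (mul_mem hqA heA) (sub_mem (one_mem _) hqA)) _, ?_, ?_, ?_, ?_, ?_⟩
  · intro h0
    have h1 : q * e * (1 - q) = 0 := (smul_eq_zero.1 h0).resolve_left two_ne_zero
    have h2 : e = 0 := by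
      have h3 : e * (q * e * (1 - q)) * e = (4⁻¹ : ℂ) • e := by
        calc e * (q * e * (1 - q)) * e = (e * q * e) * (1 - q) * e := by simp only [mul_assoc]
          _ = (2⁻¹ : ℂ) • (e * (1 - q) * e) := by rw [heqe']; simp only [smul_mul_assoc]
          _ = _ := by rw [heqe'', smul_smul]; norm_num
      rw [h1, mul_zero, zero_mul] at h3
      exact (smul_eq_zero.1 h3.symm).resolve_left (by norm_num)
    have h3 : h⁺ = 0 := by rw [← rangeProj_mul (h⁺), ← he, h2, zero_mul]
    have h4 : h = 0 := by
      rw [← CFC.posPart_sub_negPart h hhs, ← hconj, h3, mul_zero, zero_mul, sub_zero]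
    have h5 : q * a * (1 - q) = 0 := by
      have : q * h * (1 - q) = q * a * (1 - q) := by
        calc q * h * (1 - q) = (q * q) * a * ((1 - q) * (1 - q))
              + q * (1 - q) * a * q * (1 - q) := by
              rw [hh]; simp only [mul_add, add_mul, mul_assoc]
          _ = _ := by rw [hqq, hq1, hq3]; simp only [zero_mul, add_zero]
      rw [← this, h4, mul_zero, zero_mul]
    have h6 : q * a = q * a * q := by rwa [mul_sub, mul_one, sub_eq_zero] at h5
    refine hqa ?_
    have h7 := congrArg star h6
    simp only [star_mul, hqs, has.star_eq, ← mul_assoc] at h7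
    rw [h6, ← h7]
  · rw [smul_mul_smul_comm, show q * e * (1 - q) * (q * e * (1 - q)) =
      q * e * ((1 - q) * q) * (e * (1 - q)) by simp only [mul_assoc], hq2, mul_zero, zero_mul,
      smul_zero]
  · rw [star_smul, hst, smul_mul_smul_comm, smul_mul_smul_comm]
    have : q * e * (1 - q) * ((1 - q) * e * q) * (q * e * (1 - q)) =
        (4⁻¹ : ℂ) • (q * e * (1 - q)) := by
      calc q * e * (1 - q) * ((1 - q) * e * q) * (q * e * (1 - q))
          = q * (e * ((1 - q) * (1 - q)) * e) * (q * q) * e * (1 - q) := by simp only [mul_assoc]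
        _ = (2⁻¹ : ℂ) • (q * (e * q * e) * (1 - q)) := by
            rw [hq1, hqq, heqe'']; simp only [mul_assoc, smul_mul_assoc, mul_smul_comm]
        _ = _ := by
            rw [heqe', mul_smul_comm, smul_mul_assoc, smul_smul]; norm_num
    rw [this, smul_smul]
    norm_num
  · rw [mul_smul_comm, ← mul_assoc, ← mul_assoc, hrq]
  · rw [smul_mul_assoc, mul_assoc, ← hqrq, ← mul_assoc, mul_assoc q, her]

end NilpotentPartialIsometries

/-! ### Commuting spins in a type II₁ algebra -/

section Spins
open ContinuousLinearMap

variable {H : Type*} [NormedAddCommGroup H] [InnerProductSpace ℂ H] [CompleteSpace H]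

/-- Partial isometries with pairwise orthogonal ranges and pairwise orthogonal initial spaces have a
strongly convergent sum. -/
theorem exists_hasSum_partialIsometry (F : Set (H →L[ℂ] H))
    (hF : ∀ v ∈ F, v * star v * v = v)
    (hF₁ : ∀ v ∈ F, ∀ w ∈ F, v ≠ w → star v * w = 0)
    (hF₂ : ∀ v ∈ F, ∀ w ∈ F, v ≠ w → v * star w = 0) :
    ∃ T : H →L[ℂ] H, ∀ x, HasSum (fun v : F => (v : H →L[ℂ] H) x) (T x) := by
  classical
  have hin : ∀ (v w : H →L[ℂ] H) x y, inner ℂ (v x) (w y) = inner ℂ x ((star v * w) y) := by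
    intro v w x y
    rw [star_eq_adjoint]
    exact (adjoint_inner_right v x (w y)).symm
  have horth : OrthogonalFamily ℂ (fun v : F => LinearMap.range ((v : H →L[ℂ] H) : H →ₗ[ℂ] H))
      (fun v => (LinearMap.range ((v : H →L[ℂ] H) : H →ₗ[ℂ] H)).subtypeₗᵢ) := by
    rintro v w hvw ⟨_, x, rfl⟩ ⟨_, y, rfl⟩
    change inner ℂ ((v : H →L[ℂ] H) x) ((w : H →L[ℂ] H) y) = 0
    rw [hin, hF₁ v v.2 w w.2 (fun h => hvw (Subtype.ext h))]
    simp
  have hnorm : ∀ x (s : Finset F), ∑ v ∈ s, ‖(v : H →L[ℂ] H) x‖ ^ 2 ≤ ‖x‖ ^ 2 := by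
    intro x s
    set y := ∑ v ∈ s, (star (v : H →L[ℂ] H) * v) x with hy
    have hvy : ∀ w ∈ s, (w : H →L[ℂ] H) y = (w : H →L[ℂ] H) x := by
      intro w hw
      rw [hy, map_sum, Finset.sum_eq_single_of_mem w hw]
      · change ((w : H →L[ℂ] H) * (star (w : H →L[ℂ] H) * w)) x = _
        rw [← mul_assoc, hF w w.2]
      · intro v _ hvw
        change ((w : H →L[ℂ] H) * (star (v : H →L[ℂ] H) * v)) x = _
        rw [← mul_assoc, hF₂ w w.2 v v.2 (fun h => hvw (Subtype.ext h.symm)), zero_mul]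
        rfl
    have h1 : inner ℂ x y = ((∑ v ∈ s, ‖(v : H →L[ℂ] H) x‖ ^ 2 : ℝ) : ℂ) := by
      rw [hy, inner_sum]
      push_cast
      refine Finset.sum_congr rfl fun v _ => ?_
      refine (hin (v : H →L[ℂ] H) v x x).symm.trans ?_
      rw [inner_self_eq_norm_sq_to_K]
      rfl
    have h2 : inner ℂ y y = ((∑ v ∈ s, ‖(v : H →L[ℂ] H) x‖ ^ 2 : ℝ) : ℂ) := by
      nth_rewrite 2 [hy]
      rw [inner_sum]
      push_cast
      refine Finset.sum_congr rfl fun v hv => ?_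
      refine (hin (v : H →L[ℂ] H) v y x).symm.trans ?_
      rw [hvy v hv, inner_self_eq_norm_sq_to_K]
      rfl
    have h3 : ‖y‖ ^ 2 = ∑ v ∈ s, ‖(v : H →L[ℂ] H) x‖ ^ 2 := by
      rw [inner_self_eq_norm_sq_to_K] at h2
      exact Complex.ofReal_injective (by rw [← h2]; push_cast; rfl)
    have h4 : ‖inner ℂ x y‖ ≤ ‖x‖ * ‖y‖ := norm_inner_le_norm x y
    rw [h1, Complex.norm_real, Real.norm_of_nonneg (by positivity), ← h3] at h4
    rw [← h3]
    nlinarith [sq_nonneg (‖x‖ - ‖y‖), norm_nonneg x, norm_nonneg y]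
  have hsum : ∀ x, Summable fun v : F => (v : H →L[ℂ] H) x := by
    intro x
    have := (horth.summable_iff_norm_sq_summable
      (fun v : F => ⟨(v : H →L[ℂ] H) x, ⟨x, rfl⟩⟩)).2
      (summable_of_sum_le (fun v => by positivity) (hnorm x))
    exact this
  refine ⟨LinearMap.mkContinuous
    { toFun := fun x => ∑' v : F, (v : H →L[ℂ] H) x
      map_add' := fun x y => by
        simp only [map_add]; exact (hsum x).tsum_add (hsum y)
      map_smul' := fun c x => by
        simp only [map_smul]; exact (hsum x).tsum_const_smul c } 1 ?_, fun x => (hsum x).hasSum⟩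
  intro x
  rw [one_mul]
  refine le_of_tendsto (hsum x).hasSum.norm (Filter.Eventually.of_forall fun s => ?_)
  have h1 := horth.norm_sum (fun v : F => ⟨(v : H →L[ℂ] H) x, ⟨x, rfl⟩⟩) s
  have h2 : ‖∑ v ∈ s, (v : H →L[ℂ] H) x‖ ^ 2 ≤ ‖x‖ ^ 2 := by
    refine le_trans (le_of_eq ?_) (hnorm x s)
    exact h1
  exact (sq_le_sq₀ (norm_nonneg _) (norm_nonneg _)).1 h2

/-- The families of pairwise orthogonal partial isometries with square zero in `A`. -/
def IsNilpotentFamily (A : VonNeumannAlgebra H) (F : Set (H →L[ℂ] H)) : Prop :=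
  (∀ v ∈ F, v ∈ A ∧ v * v = 0 ∧ v * star v * v = v) ∧
    ∀ v ∈ F, ∀ w ∈ F, v ≠ w → v * w = 0 ∧ star v * w = 0 ∧ v * star w = 0

/-- Halving: an algebra without abelian projections contains a unital copy of the `2 × 2` matrices,
generated by a partial isometry `v` with `v² = 0` and `v⋆v + vv⋆ = 1`. -/
theorem exists_halving (P : TracialVNA H) {A : VonNeumannAlgebra H}
    (hA : ∀ x ∈ A, x ∈ P.alg) (hN : NoAbelian A) :
    ∃ v ∈ A, v * v = 0 ∧ star v * v + v * star v = 1 := by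
  obtain ⟨F, hF⟩ := zorn_subset {F | IsNilpotentFamily A F} (by
    intro c hc hchain
    refine ⟨⋃₀ c, ⟨?_, ?_⟩, fun s hs => Set.subset_sUnion_of_mem hs⟩
    · rintro v ⟨s, hs, hv⟩
      exact (hc hs).1 v hv
    · rintro v ⟨s, hs, hv⟩ w ⟨t, ht, hw⟩ hvw
      rcases hchain.total hs ht with h | h
      · exact (hc ht).2 v (h hv) w hw hvw
      · exact (hc hs).2 v hv w (h hw) hvw)
  have hFn : IsNilpotentFamily A F := hF.prop
  obtain ⟨T, hT⟩ := exists_hasSum_partialIsometry F (fun v hv => (hFn.1 v hv).2.2)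
    (fun v hv w hw h => (hFn.2 v hv w hw h).2.1) (fun v hv w hw h => (hFn.2 v hv w hw h).2.2)
  have hTA : T ∈ A := by
    rw [mem_iff_commute]
    intro y hy
    ext x
    have h1 := (hT x).mapL y
    have h2 := hT (y x)
    refine h1.unique (by
      convert h2 using 1
      · funext v
        exact congrArg (fun f : H →L[ℂ] H => f x) (commutant_commute (hFn.1 v v.2).1 hy)
      · rfl)
  -- products of `T` with operators are determined termwise
  have hmulT : ∀ S R : H →L[ℂ] H, (∀ v ∈ F, S * v = R * v) → S * T = R * T := by
    intro S R h
    ext x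
    have h1 := (hT x).mapL S
    have h2 := (hT x).mapL R
    refine h1.unique (by
      convert h2 using 1
      · funext v
        exact congrArg (fun f : H →L[ℂ] H => f x) (h v v.2)
      · rfl)
  have hTmul : ∀ v ∈ F, ∀ S : H →L[ℂ] H, (∀ w ∈ F, w ≠ v → w * S = 0) → T * S = v * S := by
    intro v hv S h
    ext x
    refine (hT (S x)).unique (hasSum_single (⟨v, hv⟩ : F) ?_)
    intro w hw
    exact congrArg (fun f : H →L[ℂ] H => f x) (h w w.2 (fun h => hw (Subtype.ext h)))
  have hTv : ∀ v ∈ F, T * v = 0 := by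
    intro v hv
    rw [hTmul v hv v fun w hw h => (hFn.2 w hw v hv h).1, (hFn.1 v hv).2.1]
  have hTT : T * T = 0 := by
    rw [hmulT T 0 (fun v hv => by rw [hTv v hv, zero_mul]), zero_mul]
  have hTsv : ∀ v ∈ F, T * star v = v * star v := by
    intro v hv
    exact hTmul v hv (star v) fun w hw h => (hFn.2 w hw v hv h).2.2
  have hsvT : ∀ v ∈ F, star v * T = star v * v := by
    intro v hv
    ext x
    have h1 := (hT x).mapL (star v)
    refine h1.unique (hasSum_single (⟨v, hv⟩ : F) ?_)
    intro w hw
    exact congrArg (fun f : H →L[ℂ] H => f x)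
      (hFn.2 v hv w w.2 (fun h => hw (Subtype.ext h.symm))).2.1
  have hsTv : ∀ v ∈ F, star T * v = star v * v := by
    intro v hv
    simpa using congrArg star (hsvT v hv)
  have hvT : ∀ v ∈ F, v * T = 0 := by
    intro v hv
    ext x
    have h1 := (hT x).mapL v
    refine h1.unique ?_
    rw [zero_apply]
    convert hasSum_zero using 2 with w
    by_cases h : (w : H →L[ℂ] H) = v
    · rw [h]
      exact congrArg (fun f : H →L[ℂ] H => f x) (hFn.1 v hv).2.1
    · exact congrArg (fun f : H →L[ℂ] H => f x) (hFn.2 v hv w w.2 (Ne.symm h)).1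
  have hTTT : T * star T * T = T := by
    have := hmulT (T * star T) 1 (fun v hv => by
      rw [mul_assoc, hsTv v hv, ← mul_assoc, hTsv v hv, (hFn.1 v hv).2.2, one_mul])
    rw [this, one_mul]
  have hsTsT : star T * star T = 0 := by rw [← star_mul, hTT, star_zero]
  have hTTT' : star T * T * star T = star T := by
    have := congrArg star hTTT
    simpa [mul_assoc] using this
  set E : H →L[ℂ] H := star T * T + T * star T with hE
  have hEv : ∀ v ∈ F, E * v = v := by
    intro v hv
    rw [hE, add_mul, mul_assoc, hTv v hv, mul_zero, zero_add, mul_assoc, hsTv v hv, ← mul_assoc,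
      hTsv v hv, (hFn.1 v hv).2.2]
  have hvE : ∀ v ∈ F, v * E = v := by
    intro v hv
    have h1 : v * star T = v * star v := by simpa using congrArg star (hTsv v hv)
    rw [hE, mul_add, ← mul_assoc, ← mul_assoc, hvT v hv, zero_mul, add_zero, h1, mul_assoc,
      hsvT v hv, ← mul_assoc, (hFn.1 v hv).2.2]
  have hEs : star E = E := by rw [hE]; simp
  have hEE : E * E = E := by
    rw [hE]
    simp only [add_mul, mul_add]
    rw [← mul_assoc, hTTT', mul_assoc (T) (star T) (star T * T), ← mul_assoc (star T) (star T),
      hsTsT, mul_assoc (star T) T (T * star T), ← mul_assoc T T, hTT,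
      ← mul_assoc (T * star T), hTTT]
    simp
  have hr : IsStarProjection (1 - E) :=
    IsStarProjection.one_sub ⟨hEE, hEs⟩
  have hEA : E ∈ A := add_mem (mul_mem (star_mem hTA) hTA) (mul_mem hTA (star_mem hTA))
  by_cases h0 : 1 - E = 0
  · exact ⟨T, hTA, hTT, (sub_eq_zero.1 h0).symm⟩
  exfalso
  obtain ⟨u, huA, hu0, huu, huuu, hru, hur⟩ :=
    exists_nilpotent_partialIsometry P hA hN (sub_mem (one_mem _) hEA) hr h0
  have hEu : E * u = 0 := by
    rwa [sub_mul, one_mul, sub_eq_self] at hru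
  have huE : u * E = 0 := by
    rwa [mul_sub, mul_one, sub_eq_self] at hur
  have hEu' : E * star u = 0 := by rw [← hEs, ← star_mul, huE, star_zero]
  have huE' : star u * E = 0 := by rw [← hEs, ← star_mul, hEu, star_zero]
  have hsE : ∀ v ∈ F, star v * E = star v := fun v hv => by
    simpa [hEs] using congrArg star (hEv v hv)
  have hEs' : ∀ v ∈ F, E * star v = star v := fun v hv => by
    simpa [hEs] using congrArg star (hvE v hv)
  have hnew : IsNilpotentFamily A (insert u F) := by
    refine ⟨?_, ?_⟩
    · rintro v (rfl | hv)
      · exact ⟨huA, huu, huuu⟩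
      · exact hFn.1 v hv
    · rintro v (rfl | hv) w (rfl | hw) hvw
      · exact absurd rfl hvw
      · refine ⟨?_, ?_, ?_⟩
        · rw [← hEv w hw, ← mul_assoc, huE, zero_mul]
        · rw [← hEv w hw, ← mul_assoc, huE', zero_mul]
        · rw [← hEs' w hw, ← mul_assoc, huE, zero_mul]
      · refine ⟨?_, ?_, ?_⟩
        · rw [← hvE v hv, mul_assoc, hEu, mul_zero]
        · rw [← hsE v hv, mul_assoc, hEu, mul_zero]
        · rw [← hvE v hv, mul_assoc, hEu', mul_zero]
      · exact hFn.2 v hv w hw hvw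
  have huF : u ∈ F := hF.le_of_ge hnew (Set.subset_insert u F) (Set.mem_insert u F)
  exact hu0 (by rw [← hEv u huF, hEu])

/-- The relative commutant of an operator and its adjoint in a von Neumann algebra. -/
def relCommutant (A : VonNeumannAlgebra H) (v : H →L[ℂ] H) : VonNeumannAlgebra H :=
  (generated ((A.commutant : Set (H →L[ℂ] H)) ∪ {v})).commutant

theorem mem_relCommutant {A : VonNeumannAlgebra H} {v x : H →L[ℂ] H} :
    x ∈ relCommutant A v ↔ x ∈ A ∧ v * x = x * v ∧ star v * x = x * star v := by
  have h1 : x ∈ relCommutant A v ↔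
      x ∈ StarSubalgebra.centralizer ℂ ((A.commutant : Set (H →L[ℂ] H)) ∪ {v}) := by
    rw [relCommutant, VonNeumannAlgebra.mem_commutant_iff]
    constructor
    · intro h
      rw [StarSubalgebra.mem_centralizer_iff]
      have hsub : ∀ g ∈ (A.commutant : Set (H →L[ℂ] H)) ∪ {v},
          g ∈ generated ((A.commutant : Set (H →L[ℂ] H)) ∪ {v}) := by
        intro g hg
        change g ∈ StarSubalgebra.centralizer ℂ _
        rw [StarSubalgebra.mem_centralizer_iff]
        intro z hz
        rw [SetLike.mem_coe, StarSubalgebra.mem_centralizer_iff] at hz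
        exact ⟨((hz g hg).1).symm, by simpa using (congrArg star (hz g hg).2)⟩
      intro g hg
      exact ⟨h g (hsub g hg), h _ (star_mem (hsub g hg))⟩
    · intro h g hg
      change g ∈ StarSubalgebra.centralizer ℂ _ at hg
      rw [StarSubalgebra.mem_centralizer_iff] at hg
      exact ((hg x h).1).symm
  rw [h1, StarSubalgebra.mem_centralizer_iff, mem_iff_commute]
  constructor
  · intro h
    exact ⟨fun y hy => (h y (Or.inl hy)).1, h v (Or.inr rfl)⟩
  · rintro ⟨h, h'⟩ g (hg | rfl)
    · exact ⟨h g hg, h _ (star_mem (s := A.commutant) hg)⟩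
    · exact h'

/-- Splitting off a copy of the `2 × 2` matrices leaves no abelian projections: with `e = v⋆v`, the
corner `feAfe` embeds into `f (A ∩ {v, v⋆}') f` by `x ↦ x + v x v⋆`. -/
theorem noAbelian_relCommutant {A : VonNeumannAlgebra H} (hN : NoAbelian A) {v : H →L[ℂ] H}
    (hvA : v ∈ A) (hvv : v * v = 0) (hv1 : star v * v + v * star v = 1) :
    NoAbelian (relCommutant A v) := by
  intro f hf hfp hab
  obtain ⟨hfA, hfv, hfv'⟩ := mem_relCommutant.1 hf
  have hff : f * f = f := hfp.isIdempotentElem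
  have hfs : star f = f := hfp.isSelfAdjoint
  have hvv' : star v * star v = 0 := by rw [← star_mul, hvv, star_zero]
  obtain ⟨e, he⟩ : ∃ e, e = star v * v := ⟨_, rfl⟩
  rw [← he] at hv1
  have hve : v * e = v := by
    have := congrArg (v * ·) hv1
    simpa [mul_add, ← mul_assoc, hvv, he] using this
  have hev : e * v = 0 := by rw [he, mul_assoc, hvv, mul_zero]
  have hes : star e = e := by rw [he]; simp
  have hve' : star v * e = 0 := by simpa [hes] using congrArg star hev
  have hee : e * e = e := by
    nth_rewrite 1 [he]; rw [mul_assoc, hve, he]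
  have hfe : f * e = e * f := by rw [he, ← mul_assoc, ← hfv', mul_assoc, ← hfv, mul_assoc]
  have heA : e ∈ A := he ▸ mul_mem (star_mem hvA) hvA
  have hfeA : f * e ∈ A := mul_mem hfA heA
  have hfep : IsStarProjection (f * e) := by
    refine ⟨?_, ?_⟩
    · change f * e * (f * e) = f * e
      rw [mul_assoc, ← mul_assoc e, ← hfe, mul_assoc f e e, hee, ← mul_assoc, hff]
    · rw [IsSelfAdjoint, star_mul, hfs, hes, hfe]
  -- the amplification `x ↦ x + v x v⋆` of the corner
  have amp : ∀ x ∈ A, ∃ t ∈ relCommutant A v, f * t * f = t ∧ t * e = f * e * x * (f * e) ∧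
      e * t = f * e * x * (f * e) := by
    intro x hx
    obtain ⟨z, hz⟩ : ∃ z, z = f * e * x * (f * e) := ⟨_, rfl⟩
    rw [← hz]
    have hzA : z ∈ A := hz ▸ mul_mem (mul_mem hfeA hx) hfeA
    have hze : z * e = z := by rw [hz, mul_assoc, mul_assoc f e e, hee]
    have hez : e * z = z := by
      have : e * (f * e) = f * e := by rw [← mul_assoc, ← hfe, mul_assoc, hee]
      rw [hz, mul_assoc (f * e) x, ← mul_assoc _ (f * e), this]
    have hfz : f * z = z := by
      have : f * (f * e) = f * e := by rw [← mul_assoc, hff]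
      rw [hz, mul_assoc (f * e) x, ← mul_assoc _ (f * e), this]
    have hzf : z * f = z := by
      rw [hz, mul_assoc _ (f * e) f, mul_assoc f e f, ← hfe, ← mul_assoc f f e, hff]
    have hzv : z * v = 0 := by rw [← hze, mul_assoc, hev, mul_zero]
    have hvz : star v * z = 0 := by rw [← hez, ← mul_assoc, hve', zero_mul]
    refine ⟨z + v * z * star v, ?_, ?_, ?_, ?_⟩
    · rw [mem_relCommutant]
      refine ⟨add_mem hzA (mul_mem (mul_mem hvA hzA) (star_mem hvA)), ?_, ?_⟩
      · rw [mul_add, add_mul, hzv, ← mul_assoc, ← mul_assoc, hvv, zero_mul, zero_mul, add_zero,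
          zero_add, mul_assoc (v * z), ← he, mul_assoc, hze]
      · rw [mul_add, add_mul, hvz, ← mul_assoc, ← mul_assoc, ← he, hez, mul_assoc (v * z), hvv',
          mul_zero, zero_add, add_zero]
    · rw [mul_add, add_mul, hfz, hzf, ← mul_assoc, ← mul_assoc, ← hfv, mul_assoc v f z, hfz,
        mul_assoc (v * z), hfv', ← mul_assoc, mul_assoc v z f, hzf]
    · rw [add_mul, hze, mul_assoc, hve', mul_zero, add_zero]
    · rw [mul_add, hez, ← mul_assoc, ← mul_assoc, hev, zero_mul, zero_mul, add_zero]
  have h0 : f * e = 0 := by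
    refine hN (f * e) hfeA hfep fun x hx y hy => ?_
    obtain ⟨s, hs, hfs, hse, hes⟩ := amp x hx
    obtain ⟨t, ht, hft, hte, het⟩ := amp y hy
    have h1 := hab s hs t ht
    rw [hfs, hft] at h1
    calc f * e * x * (f * e) * (f * e * y * (f * e)) = e * (s * t) * e := by
          rw [← hes, ← hte]; simp only [mul_assoc]
      _ = e * (t * s) * e := by rw [h1]
      _ = _ := by rw [← het, ← hse]; simp only [mul_assoc]
  calc f = f * e + f * (v * star v) := by rw [← mul_add, hv1, mul_one]
    _ = v * (f * e) * star v := by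
        rw [h0, zero_add, mul_zero, zero_mul, ← hve, ← mul_assoc, ← mul_assoc, ← hfv,
          mul_assoc v f e, h0, mul_zero, zero_mul]
    _ = 0 := by rw [h0, mul_zero, zero_mul]

/-- A type II₁ algebra contains infinitely many pairwise commuting spins: self-adjoint unitaries
`uₙ`, `Vₙ` with `Vₙ uₙ = -uₙ Vₙ`, where `Vₘ` commutes with `uₙ` for `m ≠ n`. -/
theorem exists_spins (P : TracialVNA H) (hP : IsTypeIIOne P.Elem) :
    ∃ u V : ℕ → P.Elem, (∀ n, star (u n) = u n) ∧ (∀ n, u n * u n = 1) ∧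
      (∀ n, star (V n) = V n) ∧ (∀ n, V n * V n = 1) ∧ (∀ n, V n * u n = -(u n * V n)) ∧
      ∀ m n, m ≠ n → V m * u n = u n * V m := by
  have hN : NoAbelian P.alg := by
    intro p hp hpp hab
    have h := hP.no_abelian (⟨p, hp⟩ : P.Elem) ⟨Subtype.ext hpp.isIdempotentElem,
      Subtype.ext hpp.isSelfAdjoint⟩ fun x y => Subtype.ext (hab x x.2 y y.2)
    exact congrArg Subtype.val h
  let St := {A : VonNeumannAlgebra H // (∀ x ∈ A, x ∈ P.alg) ∧ NoAbelian A}
  choose w hwA hww hw1 using fun A : St => exists_halving P A.2.1 A.2.2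
  let next : St → St := fun A => ⟨relCommutant A.1 (w A),
    fun x hx => A.2.1 x (mem_relCommutant.1 hx).1,
    noAbelian_relCommutant A.2.2 (hwA A) (hww A) (hw1 A)⟩
  let B : ℕ → St := fun n => next^[n] ⟨P.alg, fun _ h => h, hN⟩
  have hB : ∀ n, B (n + 1) = next (B n) := fun n => Function.iterate_succ_apply' _ _ _
  have hanti : ∀ m n, m ≤ n → ∀ x ∈ (B n).1, x ∈ (B m).1 := by
    intro m n hmn
    induction n, hmn using Nat.le_induction with
    | base => exact fun x h => h
    | succ n _ ih =>
      intro x hx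
      rw [hB] at hx
      exact ih x (mem_relCommutant.1 hx).1
  have hcomm : ∀ m n, m < n → ∀ x ∈ (B n).1,
      w (B m) * x = x * w (B m) ∧ star (w (B m)) * x = x * star (w (B m)) := by
    intro m n hmn x hx
    have h := hanti (m + 1) n hmn x hx
    rw [hB] at h
    exact (mem_relCommutant.1 h).2
  have hwP : ∀ n, w (B n) ∈ P.alg := fun n => (B n).2.1 _ (hwA _)
  let v : ℕ → P.Elem := fun n => ⟨w (B n), hwP n⟩
  have hvv : ∀ n, v n * v n = 0 := fun n => Subtype.ext (hww _)
  have hvv' : ∀ n, star (v n) * star (v n) = 0 := fun n => by rw [← star_mul, hvv, star_zero]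
  have hv1 : ∀ n, star (v n) * v n + v n * star (v n) = 1 := fun n => Subtype.ext (hw1 _)
  have hvvv : ∀ n, v n * star (v n) * v n = v n := fun n => by
    have := congrArg (v n * ·) (hv1 n)
    simpa [mul_add, ← mul_assoc, hvv] using this
  have hvvv' : ∀ n, star (v n) * v n * star (v n) = star (v n) := fun n => by
    simpa [mul_assoc] using congrArg star (hvvv n)
  have hc : ∀ m n, m ≠ n → Commute (v m) (v n) ∧ Commute (star (v m)) (v n) ∧
      Commute (v m) (star (v n)) ∧ Commute (star (v m)) (star (v n)) := by
    have hlt : ∀ m n, m < n → Commute (v m) (v n) ∧ Commute (star (v m)) (v n) := fun m n h =>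
      ⟨Subtype.ext (hcomm m n h _ (hwA _)).1, Subtype.ext (hcomm m n h _ (hwA _)).2⟩
    intro m n hmn
    rcases lt_or_gt_of_ne hmn with h | h
    · obtain ⟨h1, h2⟩ := hlt m n h
      exact ⟨h1, h2, by simpa using h2.star_star, h1.star_star⟩
    · obtain ⟨h1, h2⟩ := hlt n m h
      exact ⟨h1.symm, by simpa using h2.symm.star_star, h2.symm, h1.symm.star_star⟩
  refine ⟨fun n => star (v n) * v n - v n * star (v n), fun n => v n + star (v n),
    fun n => by simp, fun n => ?_, fun n => by simp [add_comm], fun n => ?_, fun n => ?_,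
    fun m n hmn => ?_⟩
  · calc (star (v n) * v n - v n * star (v n)) * (star (v n) * v n - v n * star (v n))
        = star (v n) * v n * star (v n) * v n - star (v n) * (v n * v n) * star (v n)
          - v n * (star (v n) * star (v n)) * v n + v n * star (v n) * v n * star (v n) := by
          simp only [sub_mul, mul_sub, mul_assoc]; abel
      _ = 1 := by rw [hvv, hvv', hvvv, hvvv', ← hv1 n]; simp
  · rw [add_mul, mul_add, mul_add, hvv, hvv', ← hv1 n]; abel
  · simp only [add_mul, mul_add, sub_mul, mul_sub, ← mul_assoc, hvv, hvv', hvvv, hvvv', zero_mul]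
    simp only [mul_assoc, hvv, hvv', mul_zero]
    abel
  · obtain ⟨h1, h2, h3, h4⟩ := hc m n hmn
    exact ((h1.add_left h2).mul_right (h3.add_left h4) |> fun h => by
      exact Commute.sub_right ((h3.add_left h4).mul_right (h1.add_left h2)) h)
end Spins

/-! ### Fine partitions of a diffuse measure space -/

section Partition
open MeasureTheory

variable {Ω : Type*} [MeasurableSpace Ω] {μ : Measure Ω}

theorem IsDiffuse.exists_subset_le_half_pow [IsFiniteMeasure μ] (hμ : IsDiffuse μ) {E : Set Ω}
    (hE : MeasurableSet E) (h0 : 0 < μ E) (n : ℕ) :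
    ∃ F, MeasurableSet F ∧ F ⊆ E ∧ 0 < μ F ∧ μ F ≤ μ E * (2⁻¹ : ℝ≥0∞) ^ n := by
  induction n with
  | zero => exact ⟨E, hE, subset_rfl, h0, by simp⟩
  | succ n ih =>
    obtain ⟨F, hF, hFE, hF0, hFn⟩ := ih
    obtain ⟨G, hG, hGF, hG0, hGlt⟩ := hμ F hF hF0
    have hhalf : ∀ x : ℝ≥0∞, x ≤ μ F * 2⁻¹ → x ≤ μ E * 2⁻¹ ^ (n + 1) := fun x hx =>
      hx.trans (by rw [pow_succ, ← mul_assoc]; gcongr)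
    rcases le_total (μ G) (μ F * 2⁻¹) with h | h
    · exact ⟨G, hG, hGF.trans hFE, hG0, hhalf _ h⟩
    · refine ⟨F \ G, hF.diff hG, Set.sdiff_subset.trans hFE, ?_, hhalf _ ?_⟩
      · rw [measure_sdiff hGF hG.nullMeasurableSet (measure_ne_top _ _)]
        exact tsub_pos_of_lt hGlt
      · rw [measure_sdiff hGF hG.nullMeasurableSet (measure_ne_top _ _), tsub_le_iff_right]
        calc μ F = μ F * 2⁻¹ + μ F * 2⁻¹ := by rw [← mul_add, ENNReal.inv_two_add_inv_two, mul_one]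
          _ ≤ _ := by gcongr

theorem IsDiffuse.exists_subset_le [IsFiniteMeasure μ] (hμ : IsDiffuse μ) {E : Set Ω}
    (hE : MeasurableSet E) (h0 : 0 < μ E) {δ : ℝ≥0∞} (hδ : 0 < δ) :
    ∃ F, MeasurableSet F ∧ F ⊆ E ∧ 0 < μ F ∧ μ F ≤ δ := by
  have ht : Filter.Tendsto (fun n : ℕ => μ E * (2⁻¹ : ℝ≥0∞) ^ n) Filter.atTop (𝓝 (μ E * 0)) :=
    ENNReal.Tendsto.const_mul (ENNReal.tendsto_pow_atTop_nhds_zero_of_lt_one (by norm_num))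
      (Or.inr (measure_ne_top _ _))
  rw [mul_zero] at ht
  obtain ⟨n, hn⟩ := (ht.eventually_le_const hδ).exists
  obtain ⟨F, h1, h2, h3, h4⟩ := hμ.exists_subset_le_half_pow hE h0 n
  exact ⟨F, h1, h2, h3, h4.trans hn⟩

/-- A diffuse finite measure space splits into finitely many sets of small measure. -/
theorem IsDiffuse.exists_partition [IsFiniteMeasure μ] (hμ : IsDiffuse μ) {δ : ℝ≥0∞} (hδ : 0 < δ) :
    ∃ t : Finset (Set Ω), (∀ B ∈ t, MeasurableSet B ∧ μ B ≤ δ) ∧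
      (t : Set (Set Ω)).PairwiseDisjoint id ∧ ⋃₀ (t : Set (Set Ω)) = Set.univ := by
  classical
  let G : Set (Set Ω) := {A | ∃ t : Finset (Set Ω), (∀ B ∈ t, MeasurableSet B ∧ μ B ≤ δ) ∧
      (t : Set (Set Ω)).PairwiseDisjoint id ∧ ⋃₀ (t : Set (Set Ω)) = A}
  have hGm : ∀ A ∈ G, MeasurableSet A := by
    rintro _ ⟨t, h1, -, rfl⟩
    exact MeasurableSet.sUnion t.countable_toSet fun B hB => (h1 B hB).1
  have hGadd : ∀ A ∈ G, ∀ F, MeasurableSet F → μ F ≤ δ → Disjoint A F → A ∪ F ∈ G := by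
    rintro _ ⟨t, h1, h2, rfl⟩ F hF hFδ hd
    refine ⟨insert F t, ?_, ?_, ?_⟩
    · intro B hB
      rcases Finset.mem_insert.1 hB with rfl | hB
      · exact ⟨hF, hFδ⟩
      · exact h1 B hB
    · rw [Finset.coe_insert]
      refine h2.insert fun B hB _ => ?_
      exact (hd.mono_left (Set.subset_sUnion_of_mem hB)).symm
    · rw [Finset.coe_insert, Set.sUnion_insert, Set.union_comm]
  have hGunion : ∀ A ∈ G, ∀ A' ∈ G, A ∪ A' ∈ G := by
    rintro A hA _ ⟨t, h1, -, rfl⟩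
    induction t using Finset.induction_on with
    | empty => simpa using hA
    | insert B t _ ih =>
      have h2 := ih fun B' hB' => h1 B' (Finset.mem_insert_of_mem hB')
      obtain ⟨hB, hBδ⟩ := h1 B (Finset.mem_insert_self _ _)
      have h3 := hGadd _ h2 (B \ (A ∪ ⋃₀ (t : Set (Set Ω)))) (hB.diff (hGm _ h2))
        ((measure_mono Set.sdiff_subset).trans hBδ) Set.disjoint_sdiff_right
      rw [Set.union_sdiff_self] at h3
      rwa [Finset.coe_insert, Set.sUnion_insert, Set.union_comm B, ← Set.union_assoc]
  -- exhaust the space by unions `A n` of members of `G` whose measures approach the supremum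
  set s : ℝ≥0∞ := ⨆ A : G, μ A
  have hempty : (∅ : Set Ω) ∈ G := ⟨∅, by simp, by simp, by simp⟩
  have hsle : ∀ A ∈ G, μ A ≤ s := fun A hA => le_iSup (fun A : G => μ A) ⟨A, hA⟩
  have hsfin : s ≠ ∞ := ne_top_of_le_ne_top (measure_ne_top μ Set.univ)
    (iSup_le fun A => measure_mono (Set.subset_univ _))
  have happ : ∀ ε : ℝ≥0∞, 0 < ε → ∃ A ∈ G, s ≤ μ A + ε := by
    intro ε hε
    rcases eq_or_ne s 0 with h0 | h0
    · exact ⟨∅, hempty, by simp [h0]⟩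
    · obtain ⟨A, hA⟩ := lt_iSup_iff.1 (ENNReal.sub_lt_self hsfin h0 hε.ne' : s - ε < ⨆ A : G, μ A)
      exact ⟨A, A.2, tsub_le_iff_right.1 hA.le⟩
  choose A hAG hAs using fun n : ℕ => happ ((n : ℝ≥0∞) + 1)⁻¹ (by simp)
  have hUm : MeasurableSet (⋃ n, A n) := MeasurableSet.iUnion fun n => hGm _ (hAG n)
  have hnull : μ (⋃ n, A n)ᶜ = 0 := by
    by_contra hne
    obtain ⟨F, hF, hFU, hF0, hFδ⟩ := hμ.exists_subset_le hUm.compl (pos_iff_ne_zero.2 hne) hδ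
    have hdisj : ∀ n, Disjoint (A n) F := fun n =>
      ((disjoint_compl_right (a := ⋃ n, A n)).mono_right hFU).mono_left (Set.subset_iUnion A n)
    have hle : ∀ n : ℕ, μ F ≤ ((n : ℝ≥0∞) + 1)⁻¹ := by
      intro n
      have h1 := hsle _ (hGadd _ (hAG n) F hF hFδ (hdisj n))
      rw [measure_union (hdisj n) hF] at h1
      exact (ENNReal.add_le_add_iff_left (measure_ne_top _ _)).1 (h1.trans (hAs n))
    obtain ⟨n, hn⟩ := ENNReal.exists_inv_nat_lt hF0.ne'
    exact absurd ((hle n).trans (ENNReal.inv_le_inv.2 le_self_add)) (not_le.2 hn)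
  have hsuniv : ∀ n, μ (A n)ᶜ ≤ ((n : ℝ≥0∞) + 1)⁻¹ := by
    intro n
    have h1 : μ Set.univ ≤ s := by
      rw [← Set.union_compl_self (⋃ n, A n)]
      refine (measure_union_le _ _).trans ?_
      rw [hnull, add_zero, measure_iUnion_eq_iSup_accumulate]
      refine iSup_le fun n => hsle _ ?_
      induction n with
      | zero => simpa using hAG 0
      | succ n ih =>
        rw [Set.accumulate_succ]
        exact hGunion _ ih _ (hAG _)
    have h2 := h1.trans (hAs n)
    rw [← measure_add_measure_compl (hGm _ (hAG n))] at h2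
    exact (ENNReal.add_le_add_iff_left (measure_ne_top _ _)).1 h2
  obtain ⟨n, hn⟩ := ENNReal.exists_inv_nat_lt hδ.ne'
  obtain ⟨t, h1, h2, h3⟩ := hGadd _ (hAG n) (A n)ᶜ (hGm _ (hAG n)).compl
    ((hsuniv n).trans ((ENNReal.inv_le_inv.2 le_self_add).trans hn.le)) disjoint_compl_right
  exact ⟨t, h1, h2, by rw [h3, Set.union_compl_self]⟩

/-- A diffuse finite measure space has a sequence of measurable sets, finitely many of which form
a partition into arbitrarily small pieces. -/
theorem IsDiffuse.exists_seq [IsFiniteMeasure μ] (hμ : IsDiffuse μ) :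
    ∃ E : ℕ → Set Ω, (∀ n, MeasurableSet (E n)) ∧ ∀ δ : ℝ≥0∞, 0 < δ →
      ∃ t : Finset ℕ, (∀ n ∈ t, μ (E n) ≤ δ) ∧
        (t : Set ℕ).PairwiseDisjoint E ∧ ⋃ n ∈ t, E n = Set.univ := by
  classical
  choose t ht1 ht2 ht3 using fun n : ℕ =>
    hμ.exists_partition (δ := ((n : ℝ≥0∞) + 1)⁻¹) (by simp)
  obtain ⟨E, hE⟩ := (((Set.countable_iUnion fun n => (t n).countable_toSet).insert
    Set.univ)).exists_eq_range (Set.insert_nonempty _ _)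
  refine ⟨E, fun n => ?_, fun δ hδ => ?_⟩
  · have h : E n ∈ Set.range E := ⟨n, rfl⟩
    rw [← hE] at h
    rcases h with h | h
    · rw [h]; exact MeasurableSet.univ
    · obtain ⟨k, hk⟩ := Set.mem_iUnion.1 h
      exact (ht1 k _ hk).1
  · obtain ⟨n, hn⟩ := ENNReal.exists_inv_nat_lt hδ.ne'
    have hidx : ∀ B ∈ t n, ∃ k, E k = B := by
      intro B hB
      have : B ∈ Set.range E := by
        rw [← hE]
        exact Or.inr (Set.mem_iUnion.2 ⟨n, hB⟩)
      exact this
    choose! idx hidx using hidx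
    refine ⟨(t n).image idx, ?_, ?_, ?_⟩
    · intro k hk
      obtain ⟨B, hB, rfl⟩ := Finset.mem_image.1 hk
      rw [hidx B hB]
      exact (ht1 n B hB).2.trans ((ENNReal.inv_le_inv.2 le_self_add).trans hn.le)
    · rintro k hk l hl hkl
      obtain ⟨B, hB, rfl⟩ := Finset.mem_image.1 hk
      obtain ⟨C, hC, rfl⟩ := Finset.mem_image.1 hl
      rw [Function.onFun, hidx B hB, hidx C hC]
      exact ht2 n hB hC fun h => hkl (by rw [h])
    · rw [← ht3 n]
      ext x
      simp only [Finset.mem_image, Set.mem_iUnion, Set.mem_sUnion, Finset.mem_coe, exists_prop]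
      constructor
      · rintro ⟨_, ⟨B, hB, rfl⟩, hx⟩
        exact ⟨B, hB, by rwa [hidx B hB] at hx⟩
      · rintro ⟨B, hB, hx⟩
        exact ⟨_, ⟨B, hB, rfl⟩, by rwa [hidx B hB]⟩
end Partition

/-! ### Operators on the tensor product -/

section TensorOperators
open ContinuousLinearMap

variable {K H : Type*} [NormedAddCommGroup K] [InnerProductSpace ℂ K]
  [NormedAddCommGroup H] [InnerProductSpace ℂ H]

@[simp]
theorem leftInsert_apply (ζ : K) (h : H) :
    leftInsert ζ h = ((ζ ⊗ₜ[ℂ] h : K ⊗[ℂ] H) : HTensor K H) := rfl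

theorem norm_leftInsert_apply (ζ : K) (h : H) : ‖leftInsert ζ h‖ = ‖ζ‖ * ‖h‖ := by
  rw [leftInsert_apply, UniformSpace.Completion.norm_coe, TensorProduct.norm_tmul]

theorem continuous_leftInsert_apply (h : H) : Continuous fun ζ : K => leftInsert ζ h :=
  (UniformSpace.Completion.continuous_coe _).comp
    (TensorProduct.continuous_tmul.comp (Continuous.prodMk_left h))

theorem leftInsert_add_apply (ζ ζ' : K) (h : H) :
    leftInsert (ζ + ζ') h = leftInsert ζ h + leftInsert ζ' h := by
  simp only [leftInsert_apply, TensorProduct.add_tmul, UniformSpace.Completion.coe_add]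

theorem leftInsert_smul_apply (c : ℂ) (ζ : K) (h : H) :
    leftInsert (c • ζ) h = c • leftInsert ζ h := by
  rw [leftInsert_apply, leftInsert_apply, ← UniformSpace.Completion.coe_smul,
    TensorProduct.smul_tmul']

/-- The vectors `ζ ⊗ h` are total. -/
theorem ext_leftInsert {E : Type*} [NormedAddCommGroup E] [NormedSpace ℂ E]
    {S T : HTensor K H →L[ℂ] E} (h : ∀ ζ x, S (leftInsert ζ x) = T (leftInsert ζ x)) : S = T := by
  ext v
  induction v using UniformSpace.Completion.induction_on with
  | hp => exact isClosed_eq S.continuous T.continuous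
  | ih v =>
    induction v using TensorProduct.induction_on with
    | zero => rw [UniformSpace.Completion.coe_zero, map_zero, map_zero]
    | tmul ζ x => exact h ζ x
    | add v w hv hw => rw [UniformSpace.Completion.coe_add, map_add, map_add, hv, hw]

theorem opTensor_leftInsert (a : K →L[ℂ] K) (b : H →L[ℂ] H) (ζ : K) (x : H) :
    opTensor a b (leftInsert ζ x) = leftInsert (a ζ) (b x) := by
  rw [leftInsert_apply, opTensor_coe]; rfl

theorem opTensor_one_one : opTensor (1 : K →L[ℂ] K) (1 : H →L[ℂ] H) = 1 :=
  ext_leftInsert fun _ _ => opTensor_leftInsert _ _ _ _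

theorem opTensor_add_left (a a' : K →L[ℂ] K) (b : H →L[ℂ] H) :
    opTensor (a + a') b = opTensor a b + opTensor a' b :=
  ext_leftInsert fun ζ x => by
    rw [add_apply, opTensor_leftInsert, opTensor_leftInsert, opTensor_leftInsert, add_apply,
      leftInsert_add_apply]

theorem opTensor_zero_left (b : H →L[ℂ] H) : opTensor (0 : K →L[ℂ] K) b = 0 :=
  ext_leftInsert fun ζ x => by
    rw [opTensor_leftInsert, zero_apply, zero_apply, leftInsert_apply, TensorProduct.zero_tmul,
      UniformSpace.Completion.coe_zero]

theorem opTensor_neg_right (a : K →L[ℂ] K) (b : H →L[ℂ] H) :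
    opTensor a (-b) = -opTensor a b :=
  ext_leftInsert fun ζ x => by
    rw [neg_apply, opTensor_leftInsert, opTensor_leftInsert, neg_apply, map_neg]

variable [CompleteSpace K] [CompleteSpace H]

theorem adjoint_leftInsert_opTensor_one (ζ : K) (y : H →L[ℂ] H) :
    adjoint (leftInsert ζ) ∘L opTensor (1 : K →L[ℂ] K) y = y ∘L adjoint (leftInsert ζ) := by
  have := congrArg adjoint (opTensor_one_leftInsert ζ (star y))
  rw [adjoint_comp, adjoint_comp] at this
  rw [← star_eq_adjoint (opTensor _ _), star_opTensor, star_star, star_one] at this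
  rw [this, ← star_eq_adjoint, star_star]

theorem inner_sliceOp (ζ : K) (T : HTensor K H →L[ℂ] HTensor K H) (x y : H) :
    inner ℂ x (sliceOp ζ T y) = inner ℂ (leftInsert ζ x) (T (leftInsert ζ y)) := by
  change inner ℂ x (adjoint (leftInsert ζ) (T (leftInsert ζ y))) = _
  rw [adjoint_inner_right]

theorem sliceOp_opTensor_one_mul (ζ : K) (b : H →L[ℂ] H) (T : HTensor K H →L[ℂ] HTensor K H) :
    sliceOp ζ (opTensor 1 b * T) = b * sliceOp ζ T := by
  change adjoint (leftInsert ζ) ∘L (opTensor 1 b ∘L T) ∘L leftInsert ζ = b ∘L sliceOp ζ T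
  rw [← comp_assoc, ← comp_assoc, adjoint_leftInsert_opTensor_one, comp_assoc, comp_assoc]
  rfl

theorem sliceOp_mul_opTensor_one (ζ : K) (b : H →L[ℂ] H) (T : HTensor K H →L[ℂ] HTensor K H) :
    sliceOp ζ (T * opTensor 1 b) = sliceOp ζ T * b := by
  change adjoint (leftInsert ζ) ∘L (T ∘L opTensor 1 b) ∘L leftInsert ζ = sliceOp ζ T ∘L b
  rw [comp_assoc, opTensor_one_leftInsert, sliceOp, comp_assoc, comp_assoc]

theorem norm_sliceOp_le (ζ : K) (T : HTensor K H →L[ℂ] HTensor K H) :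
    ‖sliceOp ζ T‖ ≤ ‖ζ‖ ^ 2 * ‖T‖ := by
  have h : ‖(leftInsert ζ : H →L[ℂ] HTensor K H)‖ ≤ ‖ζ‖ :=
    opNorm_le_bound _ (norm_nonneg _) fun x => (norm_leftInsert_apply ζ x).le
  calc ‖sliceOp ζ T‖ ≤ ‖adjoint (leftInsert ζ : H →L[ℂ] HTensor K H)‖ *
        (‖T‖ * ‖(leftInsert ζ : H →L[ℂ] HTensor K H)‖) :=
        (opNorm_comp_le _ _).trans (by gcongr; exact opNorm_comp_le _ _)
    _ ≤ ‖ζ‖ * (‖T‖ * ‖ζ‖) := by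
        rw [LinearIsometryEquiv.norm_map]
        gcongr
    _ = _ := by ring

/-- Compressing by a projection of the first factor moves it into the slice vector. -/
theorem sliceOp_opTensor_mul {a : K →L[ℂ] K} (ha : star a = a) (haa : a * a = a) (ζ : K)
    {T : HTensor K H →L[ℂ] HTensor K H} (hT : opTensor a 1 * T = T * opTensor a 1) :
    sliceOp ζ (opTensor a 1 * T) = sliceOp (a ζ) T := by
  have h : opTensor a 1 * T = opTensor a 1 * T * opTensor a 1 := by
    rw [mul_assoc, ← hT, ← mul_assoc, opTensor_mul, haa, one_mul]
  have hs : adjoint (opTensor a (1 : H →L[ℂ] H)) = opTensor a 1 := by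
    rw [← star_eq_adjoint, star_opTensor, ha, star_one]
  ext y
  refine ext_inner_left ℂ fun x => ?_
  rw [inner_sliceOp, inner_sliceOp, h]
  change inner ℂ _ (opTensor a 1 (T (opTensor a 1 (leftInsert ζ y)))) = _
  rw [← adjoint_inner_left, hs, opTensor_leftInsert, opTensor_leftInsert]
  rfl

theorem opTensor_mem_vnTensor {A : VonNeumannAlgebra K} {P : VonNeumannAlgebra H}
    {a : K →L[ℂ] K} {b : H →L[ℂ] H} (ha : a ∈ A) (hb : b ∈ P) : opTensor a b ∈ vnTensor A P := by
  change _ ∈ StarSubalgebra.centralizer ℂ _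
  rw [StarSubalgebra.mem_centralizer_iff]
  intro z hz
  rw [SetLike.mem_coe, StarSubalgebra.mem_centralizer_iff] at hz
  obtain ⟨h1, h2⟩ := hz _ ⟨a, ha, b, hb, rfl⟩
  exact ⟨h1.symm, by simpa using congrArg star h2⟩

/-- An element of the centre of `A` gives an element of the centre of `A ⊗̄ P`. -/
theorem opTensor_one_right_comm {A : VonNeumannAlgebra K} {P : VonNeumannAlgebra H}
    {c : K →L[ℂ] K} (hc : c ∈ A.commutant) {T : HTensor K H →L[ℂ] HTensor K H}
    (hT : T ∈ vnTensor A P) : opTensor c 1 * T = T * opTensor c 1 := by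
  change T ∈ StarSubalgebra.centralizer ℂ _ at hT
  rw [StarSubalgebra.mem_centralizer_iff] at hT
  refine (hT _ ?_).1
  change _ ∈ StarSubalgebra.centralizer ℂ _
  rw [StarSubalgebra.mem_centralizer_iff]
  rintro _ ⟨a, ha, b, hb, rfl⟩
  rw [VonNeumannAlgebra.mem_commutant_iff] at hc
  simp only [star_opTensor, opTensor_mul, mul_one, one_mul, hc _ ha, hc _ (star_mem ha), and_self]

end TensorOperators

/-! ### Indicators, constants and the conditional expectation onto `P` -/

section Cutoff
open MeasureTheory ContinuousLinearMap

variable {Ω : Type*} [MeasurableSpace Ω] (μ : Measure Ω) [IsProbabilityMeasure μ]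

/-- Multiplication by the indicator function of a measurable set, on `L²(Ω, μ)`. -/
def indOp {B : Set Ω} (hB : MeasurableSet B) : Lp ℂ 2 μ →L[ℂ] Lp ℂ 2 μ :=
  mulOp μ (indicatorConstLp ∞ hB (measure_ne_top μ B) (1 : ℂ))

theorem coeFn_mulOp (f : Lp ℂ ∞ μ) (g : Lp ℂ 2 μ) : mulOp μ f g =ᵐ[μ] fun x => f x * g x :=
  coeFn_holder (ContinuousLinearMap.mul ℂ ℂ) f g

theorem coeFn_indOp {B : Set Ω} (hB : MeasurableSet B) (g : Lp ℂ 2 μ) :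
    indOp μ hB g =ᵐ[μ] B.indicator g := by
  filter_upwards [coeFn_mulOp μ (indicatorConstLp ∞ hB (measure_ne_top μ B) (1 : ℂ)) g,
    indicatorConstLp_coeFn (p := ∞) (hs := hB) (hμs := measure_ne_top μ B) (c := (1 : ℂ))]
    with x h1 h2
  rw [indOp, h1, h2]
  by_cases hx : x ∈ B <;> simp [hx]

theorem indOp_const {B : Set Ω} (hB : MeasurableSet B) (c : ℂ) :
    indOp μ hB (Lp.const 2 μ c) = indicatorConstLp 2 hB (measure_ne_top μ B) c := by
  apply Lp.ext
  filter_upwards [coeFn_indOp μ hB (Lp.const 2 μ c), Lp.coeFn_const 2 μ c,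
    indicatorConstLp_coeFn (p := 2) (hs := hB) (hμs := measure_ne_top μ B) (c := c)] with x h1 h2 h3
  rw [h1, h3]
  by_cases hx : x ∈ B <;> simp [hx]

theorem indOp_mul_self {B : Set Ω} (hB : MeasurableSet B) :
    indOp μ hB * indOp μ hB = indOp μ hB := by
  ext1 g
  apply Lp.ext
  change indOp μ hB (indOp μ hB g) =ᵐ[μ] indOp μ hB g
  filter_upwards [coeFn_indOp μ hB (indOp μ hB g), coeFn_indOp μ hB g] with x h1 h2
  rw [h1]
  by_cases hx : x ∈ B <;> simp [hx, h2]

theorem indOp_mul_of_disjoint {B C : Set Ω} (hB : MeasurableSet B) (hC : MeasurableSet C)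
    (h : Disjoint B C) : indOp μ hB * indOp μ hC = 0 := by
  ext1 g
  apply Lp.ext
  change indOp μ hB (indOp μ hC g) =ᵐ[μ] (0 : Lp ℂ 2 μ)
  filter_upwards [coeFn_indOp μ hB (indOp μ hC g), coeFn_indOp μ hC g, Lp.coeFn_zero ℂ 2 μ]
    with x h1 h2 h3
  rw [h1, h3]
  by_cases hx : x ∈ B
  · have hx' : x ∉ C := Set.disjoint_left.1 h hx
    simp [hx, hx', h2]
  · simp [hx]

theorem indOp_univ : indOp μ (MeasurableSet.univ) = 1 := by
  ext1 g
  apply Lp.ext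
  change indOp μ MeasurableSet.univ g =ᵐ[μ] g
  filter_upwards [coeFn_indOp μ MeasurableSet.univ g] with x h1
  simp [h1]

theorem indOp_union {B C : Set Ω} (hB : MeasurableSet B) (hC : MeasurableSet C)
    (h : Disjoint B C) : indOp μ (hB.union hC) = indOp μ hB + indOp μ hC := by
  ext1 g
  apply Lp.ext
  rw [add_apply]
  filter_upwards [coeFn_indOp μ (hB.union hC) g, coeFn_indOp μ hB g, coeFn_indOp μ hC g,
    Lp.coeFn_add (indOp μ hB g) (indOp μ hC g)] with x h1 h2 h3 h4
  rw [h1, h4, Pi.add_apply, h2, h3, Set.indicator_union_of_disjoint h]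

theorem star_indOp {B : Set Ω} (hB : MeasurableSet B) : star (indOp μ hB) = indOp μ hB := by
  rw [star_eq_adjoint]
  symm
  rw [eq_adjoint_iff]
  intro f g
  rw [L2.inner_def, L2.inner_def]
  refine integral_congr_ae ?_
  filter_upwards [coeFn_indOp μ hB f, coeFn_indOp μ hB g] with x h1 h2
  rw [h1, h2]
  by_cases hx : x ∈ B <;> simp [hx]

theorem mulOp_comm (f g : Lp ℂ ∞ μ) : mulOp μ f * mulOp μ g = mulOp μ g * mulOp μ f := by
  ext1 h
  apply Lp.ext
  change mulOp μ f (mulOp μ g h) =ᵐ[μ] mulOp μ g (mulOp μ f h)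
  filter_upwards [coeFn_mulOp μ f (mulOp μ g h), coeFn_mulOp μ g (mulOp μ f h), coeFn_mulOp μ f h,
    coeFn_mulOp μ g h] with x h1 h2 h3 h4
  rw [h1, h2, h3, h4]
  ring

theorem indOp_mem_Linfty {B : Set Ω} (hB : MeasurableSet B) : indOp μ hB ∈ Linfty μ := by
  change _ ∈ StarSubalgebra.centralizer ℂ _
  rw [StarSubalgebra.mem_centralizer_iff]
  intro z hz
  rw [SetLike.mem_coe, StarSubalgebra.mem_centralizer_iff] at hz
  obtain ⟨h1, h2⟩ := hz _ ⟨indicatorConstLp ∞ hB (measure_ne_top μ B) (1 : ℂ), rfl⟩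
  exact ⟨h1.symm, by simpa [indOp] using congrArg star h2⟩

theorem indOp_mem_commutant {B : Set Ω} (hB : MeasurableSet B) :
    indOp μ hB ∈ (Linfty μ).commutant := by
  rw [VonNeumannAlgebra.mem_commutant_iff]
  intro a ha
  change a ∈ StarSubalgebra.centralizer ℂ _ at ha
  rw [StarSubalgebra.mem_centralizer_iff] at ha
  refine ((ha _ ?_).1).symm
  rw [SetLike.mem_coe, StarSubalgebra.mem_centralizer_iff]
  rintro _ ⟨g, rfl⟩
  have h : mulOp μ g * indOp μ hB = indOp μ hB * mulOp μ g := mulOp_comm μ _ _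
  refine ⟨h, ?_⟩
  have := congrArg star h
  simpa [star_indOp] using this.symm

variable {H : Type*} [NormedAddCommGroup H] [InnerProductSpace ℂ H] [CompleteSpace H]
  (P : TracialVNA H)

/-- The central projection `1_B ⊗ 1` of `L^∞(Ω, μ) ⊗̄ P`. -/
def cutoff {B : Set Ω} (hB : MeasurableSet B) : LinftyTensor μ P :=
  ⟨opTensor (indOp μ hB) 1, opTensor_mem_vnTensor (indOp_mem_Linfty μ hB) (one_mem _)⟩

/-- The embedding `b ↦ 1 ⊗ b` of `P`. -/
def constant (b : P.Elem) : LinftyTensor μ P :=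
  ⟨opTensor 1 (b : H →L[ℂ] H), opTensor_mem_vnTensor (one_mem _) b.2⟩

/-- The slice map by `τ_μ`. -/
abbrev expectation : LinftyTensor μ P →ₗ[ℂ] P.Elem :=
  slice (Lp.const 2 μ (1 : ℂ)) (Linfty μ) P.alg

variable {μ P}

theorem constant_mul (a b : P.Elem) : constant μ P (a * b) = constant μ P a * constant μ P b :=
  Subtype.ext (by
    change opTensor _ _ = opTensor _ _ * opTensor _ _
    rw [opTensor_mul, mul_one]; rfl)

theorem constant_one : constant μ P 1 = 1 := Subtype.ext opTensor_one_one

theorem constant_neg (a : P.Elem) : constant μ P (-a) = -constant μ P a :=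
  Subtype.ext (opTensor_neg_right _ _)

theorem star_constant (a : P.Elem) : star (constant μ P a) = constant μ P (star a) :=
  Subtype.ext (by
    change star (opTensor _ _) = opTensor _ _
    rw [star_opTensor, star_one]; rfl)

theorem cutoff_comm {B : Set Ω} (hB : MeasurableSet B) (T : LinftyTensor μ P) :
    cutoff μ P hB * T = T * cutoff μ P hB :=
  Subtype.ext (opTensor_one_right_comm (indOp_mem_commutant μ hB) T.2)

theorem cutoff_mul_self {B : Set Ω} (hB : MeasurableSet B) :
    cutoff μ P hB * cutoff μ P hB = cutoff μ P hB :=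
  Subtype.ext (by
    change opTensor _ _ * opTensor _ _ = opTensor _ _
    rw [opTensor_mul, indOp_mul_self, mul_one])

theorem cutoff_mul_of_disjoint {B C : Set Ω} (hB : MeasurableSet B) (hC : MeasurableSet C)
    (h : Disjoint B C) : cutoff μ P hB * cutoff μ P hC = 0 :=
  Subtype.ext (by
    change opTensor _ _ * opTensor _ _ = 0
    rw [opTensor_mul, indOp_mul_of_disjoint μ hB hC h, opTensor_zero_left])

theorem star_cutoff {B : Set Ω} (hB : MeasurableSet B) :
    star (cutoff μ P hB) = cutoff μ P hB :=
  Subtype.ext (by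
    change star (opTensor _ _) = opTensor _ _
    rw [star_opTensor, star_indOp, star_one])

theorem cutoff_univ : cutoff μ P MeasurableSet.univ = 1 :=
  Subtype.ext (by
    change opTensor _ _ = 1
    rw [indOp_univ, opTensor_one_one])

theorem cutoff_union {B C : Set Ω} (hB : MeasurableSet B) (hC : MeasurableSet C)
    (h : Disjoint B C) : cutoff μ P (hB.union hC) = cutoff μ P hB + cutoff μ P hC :=
  Subtype.ext (by
    change opTensor _ _ = opTensor _ _ + opTensor _ _
    rw [indOp_union μ hB hC h, opTensor_add_left])

theorem cutoff_congr {B C : Set Ω} (hB : MeasurableSet B) (hC : MeasurableSet C) (h : B = C) :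
    cutoff μ P hB = cutoff μ P hC := by subst h; rfl

theorem cutoff_empty : cutoff μ P MeasurableSet.empty = 0 := by
  rw [← cutoff_mul_self, cutoff_mul_of_disjoint _ _ (Set.disjoint_empty _)]

theorem sum_cutoff {E : ℕ → Set Ω} (hE : ∀ n, MeasurableSet (E n)) (t : Finset ℕ)
    (hd : (t : Set ℕ).PairwiseDisjoint E) (hU : MeasurableSet (⋃ n ∈ t, E n)) :
    ∑ n ∈ t, cutoff μ P (hE n) = cutoff μ P hU := by
  classical
  induction t using Finset.induction_on with
  | empty =>
    rw [Finset.sum_empty, cutoff_congr hU MeasurableSet.empty (by simp), cutoff_empty]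
  | insert k t hk ih =>
    have hU' : MeasurableSet (⋃ n ∈ t, E n) := t.measurableSet_biUnion fun n _ => hE n
    have hdis : Disjoint (E k) (⋃ n ∈ t, E n) := by
      rw [Set.disjoint_iUnion₂_right]
      intro n hn
      exact hd (by simp) (by simp [hn]) (fun h => hk (h ▸ hn))
    rw [Finset.sum_insert hk, ih (hd.subset (by simp)) hU', ← cutoff_union _ _ hdis]
    exact cutoff_congr _ _ (by simp)

theorem coe_expectation (T : LinftyTensor μ P) :
    (expectation μ P T : H →L[ℂ] H) = sliceOp (Lp.const 2 μ (1 : ℂ))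
      (T : HTensor (Lp ℂ 2 μ) H →L[ℂ] HTensor (Lp ℂ 2 μ) H) := rfl

theorem expectation_constant_mul (b : P.Elem) (T : LinftyTensor μ P) :
    expectation μ P (constant μ P b * T) = b * expectation μ P T :=
  Subtype.ext (sliceOp_opTensor_one_mul _ _ _)

theorem expectation_mul_constant (b : P.Elem) (T : LinftyTensor μ P) :
    expectation μ P (T * constant μ P b) = expectation μ P T * b :=
  Subtype.ext (sliceOp_mul_opTensor_one _ _ _)

theorem norm_indicatorConstLp_one_sq {B : Set Ω} (hB : MeasurableSet B) :
    ‖indicatorConstLp 2 hB (measure_ne_top μ B) (1 : ℂ)‖ ^ 2 = μ.real B := by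
  rw [norm_indicatorConstLp (by norm_num) (by norm_num), norm_one, one_mul, ← Real.rpow_natCast,
    ← Real.rpow_mul measureReal_nonneg]
  norm_num

theorem norm_expectation_cutoff_mul_le {B : Set Ω} (hB : MeasurableSet B) (T : LinftyTensor μ P) :
    ‖expectation μ P (cutoff μ P hB * T)‖ ≤ μ.real B * ‖T‖ := by
  have h : (expectation μ P (cutoff μ P hB * T) : H →L[ℂ] H) =
      sliceOp (indicatorConstLp 2 hB (measure_ne_top μ B) (1 : ℂ))
        (T : HTensor (Lp ℂ 2 μ) H →L[ℂ] HTensor (Lp ℂ 2 μ) H) := by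
    rw [← indOp_const]
    exact sliceOp_opTensor_mul (star_indOp μ hB) (indOp_mul_self μ hB) _
      (opTensor_one_right_comm (indOp_mem_commutant μ hB) T.2)
  change ‖(expectation μ P (cutoff μ P hB * T) : H →L[ℂ] H)‖ ≤ _
  rw [h, ← norm_indicatorConstLp_one_sq hB]
  exact norm_sliceOp_le _ _

theorem leftInsert_indicatorConstLp {B : Set Ω} (hB : MeasurableSet B) (c : ℂ) (x : H) :
    leftInsert (indicatorConstLp 2 hB (measure_ne_top μ B) c) x =
      c • opTensor (indOp μ hB) (1 : H →L[ℂ] H) (leftInsert (Lp.const 2 μ (1 : ℂ)) x) := by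
  have h : Lp.const 2 μ c = c • Lp.const 2 μ (1 : ℂ) := by
    simpa using (Lp.constL 2 μ ℂ).map_smul c (1 : ℂ)
  rw [opTensor_leftInsert, ← indOp_const, h, map_smul, leftInsert_smul_apply]
  rfl

/-- The vectors `1 ⊗ x` separate the elements of `L^∞(Ω, μ) ⊗̄ P`, because they generate the space
under the centre. -/
theorem eq_zero_of_leftInsert_const {T : LinftyTensor μ P}
    (hT : ∀ x, (T : HTensor (Lp ℂ 2 μ) H →L[ℂ] HTensor (Lp ℂ 2 μ) H)
      (leftInsert (Lp.const 2 μ (1 : ℂ)) x) = 0) : T = 0 := by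
  apply Subtype.ext
  obtain ⟨S, hS⟩ := T
  change ∀ x, S (leftInsert (Lp.const 2 μ (1 : ℂ)) x) = 0 at hT
  refine ext_leftInsert fun ζ x => ?_
  change S _ = 0
  induction ζ using Lp.induction (by norm_num : (2 : ℝ≥0∞) ≠ ∞) with
  | indicatorConst c hB hμB =>
    have h := opTensor_one_right_comm (indOp_mem_commutant μ hB) hS
    have h' := congrArg (fun f => f (leftInsert (Lp.const 2 μ (1 : ℂ)) x)) h
    change opTensor _ _ (S _) = S (opTensor _ _ _) at h'
    rw [hT, map_zero] at h'
    change S (leftInsert (indicatorConstLp 2 hB hμB.ne c) x) = 0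
    rw [leftInsert_indicatorConstLp, map_smul, ← h', smul_zero]
  | add hf hg hd h1 h2 => rw [leftInsert_add_apply, map_add, h1, h2, add_zero]
  | isClosed =>
    exact isClosed_eq (S.continuous.comp (continuous_leftInsert_apply x)) continuous_const

/-- The slices of `T` over all measurable sets determine `T`: they contain the matrix coefficients
of `T` between the vectors `1_B ⊗ x` and `1 ⊗ y`. -/
theorem eq_zero_of_expectation_cutoff {T : LinftyTensor μ P}
    (hT : ∀ B (hB : MeasurableSet B), expectation μ P (cutoff μ P hB * T) = 0) : T = 0 := by
  refine eq_zero_of_leftInsert_const fun y => ?_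
  set w := (T : HTensor (Lp ℂ 2 μ) H →L[ℂ] HTensor (Lp ℂ 2 μ) H)
      (leftInsert (Lp.const 2 μ (1 : ℂ)) y)
  have key : innerSL ℂ w = 0 := by
    refine ext_leftInsert fun ζ x => ?_
    change inner ℂ w (leftInsert ζ x) = 0
    induction ζ using Lp.induction (by norm_num : (2 : ℝ≥0∞) ≠ ∞) with
    | indicatorConst c hB hμB =>
      change inner ℂ w (leftInsert (indicatorConstLp 2 hB hμB.ne c) x) = 0
      have h1 : inner ℂ x (sliceOp (Lp.const 2 μ (1 : ℂ)) (opTensor (indOp μ hB) 1 *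
          (T : HTensor (Lp ℂ 2 μ) H →L[ℂ] HTensor (Lp ℂ 2 μ) H)) y) = 0 := by
        have h2 := congrArg (fun f : P.Elem => inner ℂ x ((f : H →L[ℂ] H) y)) (hT _ hB)
        rw [coe_expectation] at h2
        exact h2.trans (inner_zero_right _)
      rw [inner_sliceOp] at h1
      change inner ℂ _ (opTensor (indOp μ hB) 1 w) = 0 at h1
      rw [← adjoint_inner_left, ← star_eq_adjoint, star_opTensor, star_indOp, star_one] at h1
      rw [leftInsert_indicatorConstLp, inner_smul_right, inner_eq_zero_symm.1 h1, mul_zero]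
    | add hf hg hd h1 h2 => rw [leftInsert_add_apply, inner_add_right, h1, h2, add_zero]
    | isClosed =>
      exact isClosed_eq (continuous_const.inner (continuous_leftInsert_apply x)) continuous_const
  have := congrArg (fun f => f w) key
  exact inner_self_eq_zero.1 this

/-- The trace of `L^∞(Ω, μ) ⊗̄ P` is faithful. -/
theorem eq_zero_of_norm2_tensorTrace {T : LinftyTensor μ P}
    (hT : norm2 (tensorTrace μ P) T = 0) : T = 0 := by
  have hin : ∀ x, inner ℂ x ((expectation μ P (star T * T) : H →L[ℂ] H) x) =
      ((‖(T : HTensor (Lp ℂ 2 μ) H →L[ℂ] HTensor (Lp ℂ 2 μ) H)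
        (leftInsert (Lp.const 2 μ (1 : ℂ)) x)‖ ^ 2 : ℝ) : ℂ) := by
    intro x
    obtain ⟨S, hS⟩ := T
    rw [coe_expectation, inner_sliceOp]
    change inner ℂ _ (star S (S _)) = ((‖S _‖ ^ 2 : ℝ) : ℂ)
    rw [star_eq_adjoint, adjoint_inner_right, inner_self_eq_norm_sq_to_K]
    push_cast
    rfl
  have hpos : 0 ≤ (expectation μ P (star T * T) : H →L[ℂ] H) := by
    rw [nonneg_iff_isPositive, isPositive_iff_complex]
    intro x
    have h := congrArg (starRingEnd ℂ) (hin x)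
    rw [inner_conj_symm, Complex.conj_ofReal] at h
    rw [h]
    exact ⟨congrArg Complex.ofReal (Complex.ofReal_re _),
      (sq_nonneg _).trans_eq (Complex.ofReal_re _).symm⟩
  have h0 : expectation μ P (star T * T) = 0 :=
    P.eq_zero_of_nonneg hpos (Real.sqrt_eq_zero'.1 hT)
  refine eq_zero_of_leftInsert_const fun x => ?_
  have h1 := hin x
  rw [h0] at h1
  have h2 := h1.symm.trans (inner_zero_right _)
  exact norm_eq_zero.1 (pow_eq_zero_iff two_ne_zero |>.1 (Complex.ofReal_eq_zero.1 h2))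

end Cutoff

/-! ### An unsolvable system in `L^∞(Ω, μ) ⊗̄ P` -/

/-- There are `aₙ, bₙ` in `A` such that any finitely many of the conditions `x⋆x = 1`, `x aₙ = bₙ x`
have a common solution `x`, but all of them together have none. -/
def HasUnsolvableSystem (A : Type*) [Ring A] [StarRing A] : Prop :=
  ∃ a b : ℕ → A, (∀ N, ∃ x : A, star x * x = 1 ∧ ∀ n < N, x * a n = b n * x) ∧
    ¬ ∃ x : A, star x * x = 1 ∧ ∀ n, x * a n = b n * x

theorem HasUnsolvableSystem.map {A B : Type*} [Ring A] [StarRing A] [Algebra ℂ A] [Ring B]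
    [StarRing B] [Algebra ℂ B] (h : HasUnsolvableSystem A) (Φ : A ≃⋆ₐ[ℂ] B) :
    HasUnsolvableSystem B := by
  obtain ⟨a, b, hfin, hinf⟩ := h
  refine ⟨fun n => Φ (a n), fun n => Φ (b n), fun N => ?_, ?_⟩
  · obtain ⟨x, hx1, hx2⟩ := hfin N
    refine ⟨Φ x, by rw [← map_star, ← map_mul, hx1, map_one], fun n hn => ?_⟩
    rw [← map_mul, ← map_mul, hx2 n hn]
  · rintro ⟨X, hX1, hX2⟩
    obtain ⟨x, rfl⟩ := EquivLike.surjective Φ X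
    refine hinf ⟨x, EquivLike.injective Φ ?_, fun n => EquivLike.injective Φ ?_⟩
    · rw [map_mul, map_star, hX1, map_one]
    · rw [map_mul, map_mul, hX2]

section Intertwiners
open MeasureTheory

/-- Given spins `uₙ`, `Vₙ` and central projections `eₙ`, the unitaries `∏ ((1 - eₙ) + eₙ Vₙ)` flip
the signs of the first `N` operators `uₙ` on `eₙ`. -/
theorem exists_finite_intertwiner {R : Type*} [Ring R] [StarRing R] {e u V : ℕ → R}
    (hes : ∀ n, star (e n) = e n) (hee : ∀ n, e n * e n = e n) (hec : ∀ n x, e n * x = x * e n)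
    (hVs : ∀ n, star (V n) = V n) (hVV : ∀ n, V n * V n = 1)
    (hVu : ∀ n, V n * u n = -(u n * V n)) (hVu' : ∀ m n, m ≠ n → V m * u n = u n * V m) (N : ℕ) :
    ∃ x : R, star x * x = 1 ∧ (∀ n < N, x * u n = (1 - e n - e n) * u n * x) ∧
      ∀ n, N ≤ n → x * u n = u n * x := by
  induction N with
  | zero => exact ⟨1, by simp, by simp, by simp⟩
  | succ N ih =>
    obtain ⟨x, hx1, hx2, hx3⟩ := ih
    have hεc : ∀ n y, (1 - e n - e n) * y = y * (1 - e n - e n) := fun n y => by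
      simp only [sub_mul, mul_sub, one_mul, mul_one, hec]
    obtain ⟨y, hy⟩ : ∃ y, y = (1 - e N) + e N * V N := ⟨_, rfl⟩
    have hyy : star y * y = 1 := by
      have h1 : (1 - e N) * (e N * V N) = 0 := by
        rw [← mul_assoc, sub_mul, one_mul, hee, sub_self, zero_mul]
      have h2 : V N * e N * (1 - e N) = 0 := by
        rw [mul_assoc, mul_sub, mul_one, hee, sub_self, mul_zero]
      have h3 : V N * e N * (e N * V N) = e N := by
        rw [mul_assoc, ← mul_assoc (e N), hee, hec, ← mul_assoc, hVV, one_mul]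
      have h4 : (1 - e N) * (1 - e N) = 1 - e N := by
        rw [sub_mul, one_mul, mul_sub, mul_one, hee, sub_self, sub_zero]
      rw [hy, star_add, star_sub, star_one, star_mul, hes, hVs, add_mul, mul_add, mul_add, h1, h2,
        h3, h4, add_zero, zero_add, sub_add_cancel]
    have hyu : ∀ n, n ≠ N → y * u n = u n * y := fun n hn => by
      rw [hy, add_mul, mul_add, sub_mul, mul_sub, one_mul, mul_one, hec, mul_assoc,
        hVu' N n hn.symm, ← mul_assoc, hec, mul_assoc, hec]
    have hyN : y * u N = (1 - e N - e N) * u N * y := by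
      have h1 : (1 - e N - e N) * y = (1 - e N) - e N * V N := by
        rw [hy, mul_add, ← mul_assoc]
        simp only [sub_mul, mul_sub, one_mul, mul_one, hee]
        abel
      rw [hεc, mul_assoc, h1, hy, add_mul, mul_sub, mul_assoc, hVu, mul_neg, ← sub_eq_add_neg,
        ← mul_assoc, ← mul_assoc, hec N (u N)]
      congr 1
      rw [sub_mul, mul_sub, one_mul, mul_one, hec]
    refine ⟨x * y, ?_, fun n hn => ?_, fun n hn => ?_⟩
    · rw [star_mul, mul_assoc, ← mul_assoc (star x), hx1, one_mul, hyy]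
    · rcases Nat.lt_succ_iff_lt_or_eq.1 hn with h | rfl
      · rw [mul_assoc, hyu n h.ne, ← mul_assoc, hx2 n h, mul_assoc]
      · rw [mul_assoc, hyN, ← mul_assoc, ← mul_assoc, ← hεc, mul_assoc _ x, hx3 n le_rfl]
        simp only [mul_assoc]
    · rw [mul_assoc, hyu n (by omega), ← mul_assoc, hx3 n (by omega), mul_assoc]

theorem TracialVNA.sq_le_norm_sq {H : Type*} [NormedAddCommGroup H] [InnerProductSpace ℂ H]
    [CompleteSpace H] (P : TracialVNA H) (x : P.Elem) : P.sq x ≤ ‖x‖ ^ 2 := by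
  simpa [P.sq_one] using P.sq_mul_le x 1

/-- Pythagoras for elements that are pairwise orthogonal with respect to the trace. -/
theorem TracialVNA.sq_sum {H : Type*} [NormedAddCommGroup H] [InnerProductSpace ℂ H]
    [CompleteSpace H] (P : TracialVNA H) (t : Finset ℕ) (x : ℕ → P.Elem)
    (h : ∀ m ∈ t, ∀ n ∈ t, m ≠ n → P.tr (star (x m) * x n) = 0) :
    P.sq (∑ n ∈ t, x n) = ∑ n ∈ t, P.sq (x n) := by
  rw [TracialVNA.sq, star_sum, Finset.sum_mul_sum, map_sum, Complex.re_sum]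
  refine Finset.sum_congr rfl fun m hm => ?_
  rw [map_sum, Finset.sum_eq_single_of_mem m hm fun n hn hnm => h m hm n hn hnm.symm]
  rfl

/-- If a self-adjoint unitary `u` anticommutes with `s` and commutes with `s'`, then `s ⊥ s'`. -/
theorem TracialVNA.tr_star_mul_eq_zero {H : Type*} [NormedAddCommGroup H] [InnerProductSpace ℂ H]
    [CompleteSpace H] (P : TracialVNA H) {u s s' : P.Elem} (hus : star u = u) (huu : u * u = 1)
    (hs : s * u = -(u * s)) (hs' : s' * u = u * s') : P.tr (star s * s') = 0 := by
  have h1 : star s * u = -(u * star s) := by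
    have := congrArg star hs
    rw [star_mul, star_neg, star_mul, hus] at this
    rw [this, neg_neg]
  have h2 : P.tr (star s * s') = -P.tr (star s * s') := by
    calc P.tr (star s * s') = P.tr (star s * (s' * u) * u) := by
          rw [mul_assoc, mul_assoc, huu, mul_one]
      _ = P.tr (star s * u * s' * u) := by rw [hs', ← mul_assoc]
      _ = -P.tr (u * (star s * s' * u)) := by
          rw [h1, ← map_neg]; simp only [neg_mul, mul_assoc]
      _ = -P.tr (star s * s') := by
          rw [P.tr_comm, mul_assoc, huu, mul_one]
  exact self_eq_neg.1 h2

variable {Ω : Type*} [MeasurableSpace Ω] {μ : Measure Ω} [IsProbabilityMeasure μ]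
  {H : Type*} [NormedAddCommGroup H] [InnerProductSpace ℂ H] [CompleteSpace H]
  {P : TracialVNA H}

/-- Let `T` flip the sign of `uₙ` exactly under the central projection `eₙ`. Its parts over a
partition of unity by the `eₙ` have pairwise orthogonal images under a `P`-bimodule map `F`, of
total square at most the mesh of the partition; so `F T` vanishes if there are arbitrarily fine
partitions. Here `m n` stands for the measure of the set of `eₙ`. -/
theorem map_eq_zero_of_intertwines {R : Type*} [Ring R] (F : R →+ P.Elem) {e a : ℕ → R}
    {u : ℕ → P.Elem} {m : ℕ → ℝ} {C : ℝ} {T : R}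
    (hus : ∀ n, star (u n) = u n) (huu : ∀ n, u n * u n = 1)
    (hFl : ∀ n S, F (a n * S) = u n * F S) (hFr : ∀ n S, F (S * a n) = F S * u n)
    (hee : ∀ n, e n * e n = e n) (hec : ∀ n S, e n * S = S * e n)
    (hF : ∀ n, ‖F (e n * T)‖ ≤ m n * C) (hm : ∀ n, 0 ≤ m n)
    (hfine : ∀ δ : ℝ, 0 < δ → ∃ t : Finset ℕ, (∀ n ∈ t, m n ≤ δ) ∧
      (∀ n ∈ t, ∀ k ∈ t, n ≠ k → e n * e k = 0) ∧ ∑ n ∈ t, e n = 1 ∧ ∑ n ∈ t, m n ≤ 1)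
    (hT : ∀ n, T * a n = (1 - e n - e n) * a n * T) : F T = 0 := by
  have key : ∀ δ : ℝ, 0 < δ → P.sq (F T) ≤ δ * C ^ 2 := by
    intro δ hδ
    obtain ⟨t, ht1, ht2, ht3, ht4⟩ := hfine δ hδ
    have hsum : F T = ∑ n ∈ t, F (e n * T) := by
      rw [← map_sum, ← Finset.sum_mul, ht3, one_mul]
    have hflip : ∀ n k, F (e n * T) * u k = F (e n * (1 - e k - e k) * (a k * T)) := by
      intro n k
      rw [← hFr, mul_assoc, hT]
      simp only [mul_assoc]
    have horth : ∀ k ∈ t, ∀ n ∈ t, k ≠ n → P.tr (star (F (e k * T)) * F (e n * T)) = 0 := by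
      intro k hk n hn hkn
      refine P.tr_star_mul_eq_zero (hus k) (huu k) ?_ ?_
      · have h1 : e k * (1 - e k - e k) * (a k * T) = -(a k * (e k * T)) := by
          rw [mul_sub, mul_sub, mul_one, hee, sub_self, zero_sub, neg_mul, ← mul_assoc, hec,
            mul_assoc]
        rw [hflip, h1, map_neg, hFl]
      · have h1 : e n * (1 - e k - e k) * (a k * T) = a k * (e n * T) := by
          rw [mul_sub, mul_sub, mul_one, ht2 n hn k hk hkn.symm, sub_zero, sub_zero, ← mul_assoc,
            hec, mul_assoc]
        rw [hflip, h1, hFl]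
    rw [hsum, P.sq_sum t _ horth]
    calc ∑ n ∈ t, P.sq (F (e n * T)) ≤ ∑ n ∈ t, m n * (δ * C ^ 2) := by
          refine Finset.sum_le_sum fun n hn => (P.sq_le_norm_sq _).trans ?_
          calc ‖F (e n * T)‖ ^ 2 ≤ (m n * C) ^ 2 := by gcongr; exact hF n
            _ = m n * (m n * C ^ 2) := by ring
            _ ≤ m n * (δ * C ^ 2) := by gcongr; exacts [hm n, ht1 n hn]
      _ = (∑ n ∈ t, m n) * (δ * C ^ 2) := by rw [Finset.sum_mul]
      _ ≤ _ := mul_le_of_le_one_left (by positivity) ht4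
  have h0 : P.sq (F T) ≤ 0 := by
    have ht : Filter.Tendsto (fun δ : ℝ => δ * C ^ 2) (𝓝[>] 0) (𝓝 (0 * C ^ 2)) :=
      (Filter.tendsto_id.mono_left nhdsWithin_le_nhds).mul_const _
    rw [zero_mul] at ht
    exact ge_of_tendsto ht (Filter.eventually_of_mem self_mem_nhdsWithin key)
  refine P.tr_faithful _ (Complex.ext (le_antisymm h0 (P.sq_nonneg _)) ?_)
  exact (Complex.le_def.1 (P.tr_nonneg _)).2.symm

theorem mul_intertwines {R : Type*} [Ring R] {z x a b : R} (hz : ∀ y, z * y = y * z)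
    (h : x * a = b * x) : z * x * a = b * (z * x) := by
  rw [mul_assoc, h, ← mul_assoc, hz, mul_assoc]

theorem expectation_eq_zero_of_intertwines {E : ℕ → Set Ω} (hE : ∀ n, MeasurableSet (E n))
    (hfine : ∀ δ : ℝ≥0∞, 0 < δ → ∃ t : Finset ℕ, (∀ n ∈ t, μ (E n) ≤ δ) ∧
        (t : Set ℕ).PairwiseDisjoint E ∧ ⋃ n ∈ t, E n = Set.univ)
    {u : ℕ → P.Elem} (hus : ∀ n, star (u n) = u n) (huu : ∀ n, u n * u n = 1)
    {T : LinftyTensor μ P} (hT : ∀ n, T * constant μ P (u n) =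
      (1 - cutoff μ P (hE n) - cutoff μ P (hE n)) * constant μ P (u n) * T) :
    expectation μ P T = 0 := by
  refine map_eq_zero_of_intertwines (expectation μ P).toAddMonoidHom
    (e := fun n => cutoff μ P (hE n)) (a := fun n => constant μ P (u n))
    (m := fun n => μ.real (E n))
    (C := ‖T‖) hus huu (fun n S => expectation_constant_mul _ _)
    (fun n S => expectation_mul_constant _ _) (fun n => cutoff_mul_self _) (fun n => cutoff_comm _)
    (fun n => norm_expectation_cutoff_mul_le _ _) (fun n => measureReal_nonneg) (fun δ hδ => ?_) hT
  obtain ⟨t, ht1, ht2, ht3⟩ := hfine (ENNReal.ofReal δ) (by simpa using hδ)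
  have hU : MeasurableSet (⋃ n ∈ t, E n) := t.measurableSet_biUnion fun n _ => hE n
  refine ⟨t, fun n hn => ENNReal.toReal_le_of_le_ofReal hδ.le (ht1 n hn),
    fun n hn k hk hnk => cutoff_mul_of_disjoint _ _ (ht2 hn hk hnk), ?_, ?_⟩
  · exact (sum_cutoff hE t ht2 hU).trans
      ((cutoff_congr hU MeasurableSet.univ ht3).trans cutoff_univ)
  · rw [← measureReal_biUnion_finset ht2 (fun n _ => hE n)]
    exact measureReal_le_one

theorem nontrivial_LinftyTensor : (1 : LinftyTensor μ P) ≠ 0 := by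
  intro h
  have h1 : ∀ x : H, x = 0 := by
    intro x
    have h2 : leftInsert (Lp.const 2 μ (1 : ℂ)) x = 0 :=
      congrArg (fun f : LinftyTensor μ P => (f : HTensor (Lp ℂ 2 μ) H →L[ℂ] HTensor (Lp ℂ 2 μ) H)
        (leftInsert (Lp.const 2 μ (1 : ℂ)) x)) h
    have h3 := norm_leftInsert_apply (Lp.const 2 μ (1 : ℂ)) x
    have h5 : ‖Lp.const 2 μ (1 : ℂ)‖ = 1 := by
      have := Lp.norm_const' (μ := μ) (p := 2) (c := (1 : ℂ)) (by norm_num) (by norm_num)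
      rw [this]
      simp
    rw [h2, norm_zero, h5, one_mul] at h3
    exact norm_eq_zero.1 h3.symm
  have h4 : (1 : P.Elem) = 0 := Subtype.ext (ContinuousLinearMap.ext fun x => h1 _)
  have h5 := P.tr_one
  rw [h4, map_zero] at h5
  exact zero_ne_one h5

/-- The system asks for an isometry that flips the sign of every `1 ⊗ uₙ` exactly over `Eₙ`. -/
theorem hasUnsolvableSystem_LinftyTensor (hμ : IsDiffuse μ) (hP : IsTypeIIOne P.Elem) :
    HasUnsolvableSystem (LinftyTensor μ P) := by
  obtain ⟨E, hE, hfine⟩ := hμ.exists_seq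
  obtain ⟨u, V, hus, huu, hVs, hVV, hVu, hVu'⟩ := exists_spins P hP
  refine ⟨fun n => constant μ P (u n),
    fun n => (1 - cutoff μ P (hE n) - cutoff μ P (hE n)) * constant μ P (u n), fun N => ?_, ?_⟩
  · obtain ⟨x, h1, h2, -⟩ := exists_finite_intertwiner (e := fun n => cutoff μ P (hE n))
      (u := fun n => constant μ P (u n)) (V := fun n => constant μ P (V n))
      (fun n => star_cutoff _) (fun n => cutoff_mul_self _) (fun n => cutoff_comm _)
      (fun n => by rw [star_constant, hVs]) (fun n => by rw [← constant_mul, hVV, constant_one])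
      (fun n => by rw [← constant_mul, hVu, constant_neg, constant_mul])
      (fun m n hmn => by rw [← constant_mul, hVu' m n hmn, constant_mul]) N
    exact ⟨x, h1, h2⟩
  · rintro ⟨x, hx, hxu⟩
    have h0 : x = 0 := by
      refine eq_zero_of_expectation_cutoff fun B hB =>
        expectation_eq_zero_of_intertwines hE hfine hus huu fun n =>
          mul_intertwines (cutoff_comm hB) (hxu n)
    rw [h0, mul_zero] at hx
    exact nontrivial_LinftyTensor hx.symm

theorem norm_le_one_of_star_mul_self {x : LinftyTensor μ P} (hx : star x * x = 1) : ‖x‖ ≤ 1 := by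
  have h1 : ‖star (x : HTensor (Lp ℂ 2 μ) H →L[ℂ] HTensor (Lp ℂ 2 μ) H) * x‖ ≤ 1 := by
    rw [show star (x : HTensor (Lp ℂ 2 μ) H →L[ℂ] HTensor (Lp ℂ 2 μ) H) * x = 1 from
      congrArg Subtype.val hx]
    exact ContinuousLinearMap.norm_id_le
  rw [CStarRing.norm_star_mul_self] at h1
  change ‖(x : HTensor (Lp ℂ 2 μ) H →L[ℂ] HTensor (Lp ℂ 2 μ) H)‖ ≤ 1
  nlinarith [norm_nonneg (x : HTensor (Lp ℂ 2 μ) H →L[ℂ] HTensor (Lp ℂ 2 μ) H)]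

/-- An unsolvable system `x⋆x = 1`, `x aₙ = bₙ x` is a system of conditions `‖pₙ(x)‖₂ = 0` in the
unit ball, since isometries are contractions and the trace is faithful. -/
theorem not_countablyQFSaturated (hμ : IsDiffuse μ) (hP : IsTypeIIOne P.Elem) :
    ¬ CountablyQFSaturated (LinftyTensor μ P) (tensorTrace μ P) := by
  intro hsat
  obtain ⟨a, b, hfin, hinf⟩ := hasUnsolvableSystem_LinftyTensor (P := P) hμ hP
  let p : ℕ → StarPoly (LinftyTensor μ P) 1 := fun n => Nat.casesOn n
    (.add (.mul (.star (.var 0)) (.var 0)) (.coeff (-1)))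
    fun n => .add (.mul (.var 0) (.coeff (a n))) (.mul (.coeff (-b n)) (.var 0))
  have hp0 : ∀ x : Fin 1 → LinftyTensor μ P, (p 0).eval x = star (x 0) * x 0 - 1 := fun x =>
    (sub_eq_add_neg _ _).symm
  have hp1 : ∀ (x : Fin 1 → LinftyTensor μ P) n, (p (n + 1)).eval x = x 0 * a n - b n * x 0 :=
    fun x n => by
      rw [sub_eq_add_neg, ← neg_mul]; rfl
  have hn0 : norm2 (tensorTrace μ P) 0 = 0 := by simp [norm2]
  obtain ⟨x, -, hx⟩ := (hsat 1 p (fun _ => 0) fun _ => le_rfl).2 (by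
    intro n hn
    obtain ⟨x, hx1, hx2⟩ := hfin n
    refine ⟨fun _ => x, fun _ => norm_le_one_of_star_mul_self hx1, fun j hj => ?_⟩
    have h0 : (p j).eval (fun _ => x) = 0 := by
      cases j with
      | zero => rw [hp0, hx1, sub_self]
      | succ j => rw [hp1, hx2 j (by omega), sub_self]
    rw [h0, hn0, sub_zero, abs_zero]
    positivity)
  refine hinf ⟨x 0, ?_, fun n => ?_⟩
  · have h := eq_zero_of_norm2_tensorTrace (hx 0)
    rwa [hp0, sub_eq_zero] at h
  · have h := eq_zero_of_norm2_tensorTrace (hx (n + 1))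
    rwa [hp1, sub_eq_zero] at h

end Intertwiners

/-! ### Approximating isometries by contractions -/

section Contraction

/-- The function `2√t / (1 + t)` is at most `1`: in a C⋆-algebra, `2y(1 + y⋆y)⁻¹` is a
contraction. -/
theorem exists_contraction {A : Type*} [CStarAlgebra A] (y : A) :
    ∃ c : A, ‖c‖ ≤ 1 ∧ (1 + star y * y) * c = 1 ∧ ‖y * (c + c)‖ ≤ 1 := by
  let _ : PartialOrder A := CStarAlgebra.spectralOrder _
  have _ : StarOrderedRing A := CStarAlgebra.spectralOrderedRing _
  obtain ⟨t, ht⟩ : ∃ t, t = star y * y := ⟨_, rfl⟩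
  have ht0 : 0 ≤ t := ht ▸ star_mul_self_nonneg y
  have hts : star t = t := ht0.isSelfAdjoint
  have hu : IsUnit (1 + t) := CStarAlgebra.isUnit_of_le 1 (le_add_of_nonneg_right ht0)
  obtain ⟨v, hv⟩ := hu
  obtain ⟨c, hc⟩ : ∃ c, c = (↑v⁻¹ : A) := ⟨_, rfl⟩
  have h1 : (1 + t) * c = 1 := by rw [← hv, hc, Units.mul_inv]
  have h2 : c * (1 + t) = 1 := by rw [← hv, hc, Units.inv_mul]
  have hcs : star c = c := by
    have h3 : star c * (1 + t) = 1 := by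
      simpa [hts] using congrArg star h1
    calc star c = star c * ((1 + t) * c) := by rw [h1, mul_one]
      _ = c := by rw [← mul_assoc, h3, one_mul]
  have hone : c * ((1 + t) * (1 + t)) * c = 1 := by
    rw [← mul_assoc, h2, one_mul, h1]
  refine ⟨c, ?_, ht ▸ h1, ?_⟩
  · have h3 : star c * c ≤ 1 := by
      rw [hcs, ← sub_nonneg, ← hone, show c * ((1 + t) * (1 + t)) * c - c * c =
        c * t * c + c * t * c + c * (t * t) * c by noncomm_ring]
      have h4 : 0 ≤ c * t * c := by simpa [hcs] using star_left_conjugate_nonneg ht0 c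
      have h5 : 0 ≤ c * (t * t) * c := by
        have : 0 ≤ t * t := by simpa [hts] using star_mul_self_nonneg t
        simpa [hcs] using star_left_conjugate_nonneg this c
      positivity
    have h4 := CStarAlgebra.norm_le_norm_of_nonneg_of_le (star_mul_self_nonneg c) h3
    rw [CStarRing.norm_star_mul_self] at h4
    rcases subsingleton_or_nontrivial A with h | h
    · rw [Subsingleton.elim c 0, norm_zero]; exact zero_le_one
    · rw [CStarRing.norm_one] at h4
      nlinarith [norm_nonneg c]
  · have h3 : star (y * (c + c)) * (y * (c + c)) ≤ 1 := by
      rw [star_mul, star_add, hcs, ← sub_nonneg]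
      have e : 1 - (c + c) * star y * (y * (c + c)) = c * (star (1 - t) * (1 - t)) * c := by
        rw [star_sub, star_one, hts]
        nth_rewrite 1 [← hone]
        rw [show (c + c) * star y * (y * (c + c)) = (c + c) * (star y * y) * (c + c) by
          simp only [mul_assoc], ← ht]
        noncomm_ring
      rw [e]
      simpa [hcs] using star_left_conjugate_nonneg (star_mul_self_nonneg (1 - t)) c
    have h4 := CStarAlgebra.norm_le_norm_of_nonneg_of_le (star_mul_self_nonneg _) h3
    rw [CStarRing.norm_star_mul_self] at h4
    rcases subsingleton_or_nontrivial A with h | h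
    · rw [Subsingleton.elim (y * (c + c)) 0, norm_zero]; exact zero_le_one
    · rw [CStarRing.norm_one] at h4
      nlinarith [norm_nonneg (y * (c + c))]

/-- An element that is nearly isometric in the 2-norm is near a contraction. -/
theorem TracialVNA.exists_contraction_near {H : Type*} [NormedAddCommGroup H]
    [InnerProductSpace ℂ H] [CompleteSpace H] (N : TracialVNA H) (y : N.Elem) :
    ∃ y' : N.Elem, ‖y'‖ ≤ 1 ∧ N.sq (y - y') ≤ ‖y‖ ^ 2 * N.sq (star y * y - 1) := by
  let _ : CStarAlgebra N.Elem := StarSubalgebra.cstarAlgebra N.alg.toStarSubalgebra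
  obtain ⟨c, hc1, hc2, hc3⟩ := exists_contraction y
  refine ⟨y * (c + c), hc3, ?_⟩
  have e : y - y * (c + c) = y * ((star y * y - 1) * c) := by
    have : (star y * y - 1) * c = 1 - (c + c) := by
      have h : (1 + star y * y) * c - (c + c) = (star y * y - 1) * c := by noncomm_ring
      rw [← h, hc2]
    rw [this, mul_sub, mul_one]
  rw [e]
  refine (N.sq_mul_le _ _).trans ?_
  gcongr
  refine (N.sq_mul_le' c _).trans (mul_le_of_le_one_left (N.sq_nonneg _) ?_)
  exact pow_le_one₀ (norm_nonneg _) hc1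

end Contraction

/-! ### Solving systems in ultraproducts -/

section UltraproductSaturation
open Filter

/-- If finitely many quantities `f N 0, …, f N (N-1)` tend to zero along `U` for each `N`, then `N`
can be chosen to depend on the index so that all of them tend to zero. -/
theorem exists_diagonal {U : Ultrafilter ℕ} (hU : (U : Filter ℕ) ≤ cofinite) (f : ℕ → ℕ → ℕ → ℝ)
    (hf : ∀ N n, n < N → Tendsto (f N n) U (𝓝 0)) :
    ∃ g : ℕ → ℕ, ∀ n, Tendsto (fun k => f (g k) n k) U (𝓝 0) := by
  classical
  let A : ℕ → ℕ → Prop := fun N k => ∀ n < N, |f N n k| < 1 / ((N : ℝ) + 1)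
  have hA : ∀ N, ∀ᶠ k in (U : Filter ℕ), A N k := by
    intro N
    have : ∀ n ∈ Finset.range N, ∀ᶠ k in (U : Filter ℕ), |f N n k| < 1 / ((N : ℝ) + 1) := by
      intro n hn
      have h := (hf N n (Finset.mem_range.1 hn)).abs
      rw [abs_zero] at h
      exact h.eventually_lt_const (by positivity)
    filter_upwards [(Filter.eventually_all_finset _).2 this] with k hk n hn
    exact hk n (Finset.mem_range.2 hn)
  have hlarge : ∀ N, ∀ᶠ k in (U : Filter ℕ), N ≤ k := fun N =>
    hU (by rw [Nat.cofinite_eq_atTop]; exact eventually_ge_atTop N)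
  -- at the index `k`, use the largest stage `N ≤ k` whose errors at `k` are already small
  refine ⟨fun k => Nat.findGreatest (fun N => A N k) k, fun n => ?_⟩
  rw [Metric.tendsto_nhds]
  intro ε hε
  obtain ⟨M, hM⟩ := exists_nat_one_div_lt hε
  filter_upwards [hA (max M (n + 1)), hlarge (max M (n + 1))] with k hk1 hk2
  set G := Nat.findGreatest (fun N => A N k) k
  have hle : max M (n + 1) ≤ G := Nat.le_findGreatest hk2 hk1
  have hAG : A G k := Nat.findGreatest_spec (P := fun N => A N k) (Nat.zero_le k)
    (fun n hn => absurd hn (Nat.not_lt_zero n))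
  rw [Real.dist_eq, sub_zero]
  refine (hAG n (by omega)).trans (lt_of_le_of_lt ?_ hM)
  have : (M : ℝ) ≤ G := by exact_mod_cast (le_max_left _ _).trans hle
  gcongr

variable {K : ℕ → Type*} [∀ n, NormedAddCommGroup (K n)] [∀ n, InnerProductSpace ℂ (K n)]
  [∀ n, CompleteSpace (K n)] {N : ∀ n, TracialVNA (K n)} {U : Ultrafilter ℕ}

variable (N U) in
/-- The class of a bounded sequence in the ultraproduct. -/
def ultraMk (x : boundedSeq N) : Ultraproduct N U := Ideal.Quotient.mk (nullIdeal N U) x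

theorem ultraMk_surjective (X : Ultraproduct N U) : ∃ x, ultraMk N U x = X :=
  Ideal.Quotient.mk_surjective X

theorem ultraMk_eq_iff {x y : boundedSeq N} :
    ultraMk N U x = ultraMk N U y ↔ Tendsto (fun k => (N k).sq (x.1 k - y.1 k)) U (𝓝 0) := by
  rw [ultraMk, ultraMk, Ideal.Quotient.eq, mem_nullIdeal, tendsto_norm2_iff]
  rfl

theorem star_ultraMk (x : boundedSeq N) : star (ultraMk N U x) = ultraMk N U (star x) := rfl

theorem ultraMk_one : ultraMk N U 1 = 1 := rfl

theorem ultraMk_mul (x y : boundedSeq N) :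
    ultraMk N U (x * y) = ultraMk N U x * ultraMk N U y := rfl

theorem ultraMk_sub (x y : boundedSeq N) :
    ultraMk N U (x - y) = ultraMk N U x - ultraMk N U y := rfl

/-- Isometries of the ultraproduct lift to sequences of contractions. -/
theorem exists_contractive_lift {X : Ultraproduct N U} (hX : star X * X = 1) :
    ∃ x : boundedSeq N, (∀ k, ‖x.1 k‖ ≤ 1) ∧ ultraMk N U x = X := by
  obtain ⟨y, rfl⟩ := ultraMk_surjective X
  obtain ⟨D, hD⟩ := y.2
  choose y' hy1 hy2 using fun k => (N k).exists_contraction_near (y.1 k)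
  rw [star_ultraMk, ← ultraMk_mul, ← ultraMk_one, ultraMk_eq_iff] at hX
  refine ⟨⟨y', 1, hy1⟩, hy1, Eq.symm ?_⟩
  rw [ultraMk_eq_iff]
  refine tendsto_sq_of_le N U (C := D ^ 2) (fun k => (hy2 k).trans ?_) hX
  exact mul_le_mul_of_nonneg_right (pow_le_pow_left₀ (norm_nonneg _) (hD k) 2) ((N k).sq_nonneg _)

/-- Countable saturation of the ultraproduct for systems `x⋆x = 1`, `x aₙ = bₙ x`, together with
the requirement to commute with countably many elements. -/
theorem exists_solution_of_finite (hU : (U : Filter ℕ) ≤ cofinite) {a b d : ℕ → Ultraproduct N U}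
    {X : ℕ → Ultraproduct N U} (hX : ∀ M, star (X M) * X M = 1)
    (hab : ∀ M, ∀ n < M, X M * a n = b n * X M) (hd : ∀ M n, X M * d n = d n * X M) :
    ∃ Y : Ultraproduct N U, star Y * Y = 1 ∧ (∀ n, Y * a n = b n * Y) ∧
      ∀ n, Y * d n = d n * Y := by
  choose x hx1 hx2 using fun M => exists_contractive_lift (hX M)
  choose a' ha' using fun n => ultraMk_surjective (a n)
  choose b' hb' using fun n => ultraMk_surjective (b n)
  choose d' hd' using fun n => ultraMk_surjective (d n)
  obtain rfl : (fun n => ultraMk N U (a' n)) = a := funext ha'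
  obtain rfl : (fun n => ultraMk N U (b' n)) = b := funext hb'
  obtain rfl : (fun n => ultraMk N U (d' n)) = d := funext hd'
  obtain rfl : (fun M => ultraMk N U (x M)) = X := funext hx2
  simp only [star_ultraMk, ← ultraMk_mul, ← ultraMk_one, ultraMk_eq_iff]
    at hX hab hd
  obtain ⟨g, hg⟩ := exists_diagonal hU (fun M n k =>
    (N k).sq (star ((x M).1 k) * (x M).1 k - 1) +
    (N k).sq ((x M).1 k * (a' n).1 k - (b' n).1 k * (x M).1 k) +
    (N k).sq ((x M).1 k * (d' n).1 k - (d' n).1 k * (x M).1 k)) (fun M n hn => by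
      simpa using ((hX M).add (hab M n hn)).add (hd M n))
  refine ⟨ultraMk N U ⟨fun k => (x (g k)).1 k, 1, fun k => hx1 _ k⟩,
    ?_, fun n => ?_, fun n => ?_⟩
  · rw [star_ultraMk, ← ultraMk_mul, ← ultraMk_one, ultraMk_eq_iff]
    refine squeeze_zero (fun k => (N k).sq_nonneg _) (fun k => ?_) (hg 0)
    rw [add_assoc]
    exact le_add_of_nonneg_right (add_nonneg ((N k).sq_nonneg _) ((N k).sq_nonneg _))
  · rw [← ultraMk_mul, ← ultraMk_mul, ultraMk_eq_iff]
    refine squeeze_zero (fun k => (N k).sq_nonneg _) (fun k => ?_) (hg n)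
    rw [add_right_comm]
    exact le_add_of_nonneg_left (add_nonneg ((N k).sq_nonneg _) ((N k).sq_nonneg _))
  · rw [← ultraMk_mul, ← ultraMk_mul, ultraMk_eq_iff]
    refine squeeze_zero (fun k => (N k).sq_nonneg _) (fun k => ?_) (hg n)
    exact le_add_of_nonneg_left (add_nonneg ((N k).sq_nonneg _) ((N k).sq_nonneg _))

/-- The 2-norm of the ultraproduct is the limit along `U` of the 2-norms of the entries, so that a
strict upper bound holds for almost all entries. -/
theorem eventually_sq_lt {z : boundedSeq N} {ε : ℝ}
    (h : norm2 (ultraTrace N U) (ultraMk N U z) < ε) :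
    ∀ᶠ k in (U : Filter ℕ), (N k).sq (z.1 k) < ε ^ 2 := by
  have hε : 0 < ε := (Real.sqrt_nonneg _).trans_lt h
  rw [norm2, star_ultraMk, ← ultraMk_mul, Real.sqrt_lt' hε] at h
  have ht := tendsto_nhds_limUnder (exists_tendsto_tr N U (star z * z))
  exact ((Complex.continuous_re.tendsto _).comp ht).eventually_lt_const h

theorem TracialVNA.sq_sub_le {H : Type*} [NormedAddCommGroup H] [InnerProductSpace ℂ H]
    [CompleteSpace H] (P : TracialVNA H) (x y : P.Elem) :
    P.sq (x - y) ≤ 2 * P.sq x + 2 * P.sq y := by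
  have h := P.sq_add_le x (-y)
  rwa [← sub_eq_add_neg, show P.sq (-y) = P.sq y by simp [TracialVNA.sq]] at h

/-- An element commuting with a 2-norm dense subset of a set commutes with the whole set. -/
theorem commute_of_dense {Y s : Ultraproduct N U} {D : Set (Ultraproduct N U)}
    (hY : ∀ d ∈ D, Y * d = d * Y)
    (hs : ∀ ε > 0, ∃ d ∈ D, norm2 (ultraTrace N U) (s - d) < ε) : Y * s = s * Y := by
  obtain ⟨y, rfl⟩ := ultraMk_surjective Y
  obtain ⟨s, rfl⟩ := ultraMk_surjective s
  obtain ⟨C, hC⟩ := y.2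
  rw [← ultraMk_mul, ← ultraMk_mul, ultraMk_eq_iff, Metric.tendsto_nhds]
  intro ε hε
  obtain ⟨δ, hδ, hδε⟩ : ∃ δ > 0, 2 * (4 * C ^ 2 * δ ^ 2) < ε / 2 := by
    have ht : Tendsto (fun δ : ℝ => 2 * (4 * C ^ 2 * δ ^ 2)) (𝓝[>] 0)
        (𝓝 (2 * (4 * C ^ 2 * 0 ^ 2))) :=
      (Continuous.tendsto (by fun_prop) 0).mono_left nhdsWithin_le_nhds
    obtain ⟨δ, h1, h2⟩ := ((ht.eventually_lt_const (u := ε / 2) (by simpa using hε)).and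
      self_mem_nhdsWithin).exists
    exact ⟨δ, h2, h1⟩
  obtain ⟨d, hdD, hd⟩ := hs δ hδ
  have hYd := hY d hdD
  obtain ⟨d, rfl⟩ := ultraMk_surjective d
  rw [← ultraMk_mul, ← ultraMk_mul, ultraMk_eq_iff] at hYd
  rw [← ultraMk_sub] at hd
  filter_upwards [eventually_sq_lt hd, hYd.eventually_lt_const (show 0 < ε / 4 by positivity)]
    with k hk1 hk2
  rw [Real.dist_eq, sub_zero, abs_of_nonneg ((N k).sq_nonneg _)]
  set z := (s - d).1 k
  have e : (y * s).1 k - (s * y).1 k = (y.1 k * z - z * y.1 k) + ((y * d).1 k - (d * y).1 k) := by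
    change y.1 k * s.1 k - s.1 k * y.1 k = (y.1 k * (s.1 k - d.1 k) - (s.1 k - d.1 k) * y.1 k) +
      (y.1 k * d.1 k - d.1 k * y.1 k)
    noncomm_ring
  have hC2 : ‖y.1 k‖ ^ 2 ≤ C ^ 2 := pow_le_pow_left₀ (norm_nonneg _) (hC k) 2
  have h1 : (N k).sq (y.1 k * z - z * y.1 k) ≤ 4 * C ^ 2 * δ ^ 2 := by
    have h2 := (N k).sq_sub_le (y.1 k * z) (z * y.1 k)
    have h3 := (N k).sq_mul_le (y.1 k) z
    have h4 := (N k).sq_mul_le' (y.1 k) z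
    have h5 : ‖y.1 k‖ ^ 2 * (N k).sq z ≤ C ^ 2 * δ ^ 2 :=
      mul_le_mul hC2 hk1.le ((N k).sq_nonneg _) (sq_nonneg _)
    linarith
  have h2 := (N k).sq_add_le (y.1 k * z - z * y.1 k) ((y * d).1 k - (d * y).1 k)
  rw [e]
  linarith

end UltraproductSaturation

/-! ### Unsolvable systems and isomorphisms -/

section Ultraproduct
open MeasureTheory

variable {K : ℕ → Type*} [∀ n, NormedAddCommGroup (K n)] [∀ n, InnerProductSpace ℂ (K n)]
  [∀ n, CompleteSpace (K n)] {N : ∀ n, TracialVNA (K n)} {U : Ultrafilter ℕ}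

theorem not_hasUnsolvableSystem_ultraproduct (hU : (U : Filter ℕ) ≤ Filter.cofinite) :
    ¬ HasUnsolvableSystem (Ultraproduct N U) := by
  rintro ⟨a, b, hfin, hinf⟩
  choose X hX1 hX2 using hfin
  obtain ⟨Y, hY1, hY2, -⟩ := exists_solution_of_finite hU (d := fun _ => 1) hX1 hX2
    (fun M n => (mul_one (X M)).trans (one_mul (X M)).symm)
  exact hinf ⟨Y, hY1, hY2⟩

theorem not_hasUnsolvableSystem_relativeCommutant (hU : (U : Filter ℕ) ≤ Filter.cofinite)
    (S : NonUnitalStarSubalgebra ℂ (Ultraproduct N U))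
    (hS : IsNorm2Separable (ultraTrace N U) (S : Set (Ultraproduct N U))) :
    ¬ HasUnsolvableSystem (StarSubalgebra.centralizer ℂ (S : Set (Ultraproduct N U))) := by
  rintro ⟨a, b, hfin, hinf⟩
  choose X hX1 hX2 using hfin
  obtain ⟨D, hDS, hDc, hD⟩ := hS
  have hDne : D.Nonempty := by
    obtain ⟨d, hd, -⟩ := hD 0 (zero_mem S) 1 one_pos
    exact ⟨d, hd⟩
  obtain ⟨d, rfl⟩ := hDc.exists_eq_range hDne
  have hcomm : ∀ z : StarSubalgebra.centralizer ℂ (S : Set (Ultraproduct N U)), ∀ s ∈ S,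
      (z : Ultraproduct N U) * s = s * z := fun z s hs =>
    (((StarSubalgebra.mem_centralizer_iff ℂ).1 z.2 s hs).1).symm
  obtain ⟨Y, hY1, hY2, hY3⟩ := exists_solution_of_finite hU
    (a := fun n => (a n : Ultraproduct N U)) (b := fun n => (b n : Ultraproduct N U))
    (d := d) (X := fun M => (X M : Ultraproduct N U))
    (fun M => congrArg Subtype.val (hX1 M))
    (fun M n hn => congrArg Subtype.val (hX2 M n hn))
    (fun M n => hcomm _ _ (hDS ⟨n, rfl⟩))
  have hYS : ∀ s ∈ S, Y * s = s * Y := fun s hs =>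
    commute_of_dense (D := Set.range d) (by rintro _ ⟨n, rfl⟩; exact hY3 n) (hD s hs)
  have hYm : Y ∈ StarSubalgebra.centralizer ℂ (S : Set (Ultraproduct N U)) :=
    (StarSubalgebra.mem_centralizer_iff ℂ).2 fun s hs =>
      ⟨(hYS s hs).symm, (hYS (star s) (star_mem (s := S) hs)).symm⟩
  exact hinf ⟨⟨Y, hYm⟩, Subtype.ext hY1, fun n => Subtype.ext (hY2 n)⟩

end Ultraproduct

end TracialVN

end

theorem propositionL {Ω : Type*} [MeasurableSpace Ω] (μ : MeasureTheory.Measure Ω)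
    [MeasureTheory.IsProbabilityMeasure μ] (hμ : TracialVN.IsDiffuse μ)
    {H : Type*} [NormedAddCommGroup H] [InnerProductSpace ℂ H] [CompleteSpace H]
    (P : TracialVN.TracialVNA H) (hP : TracialVN.IsTypeIIOne P.Elem) :
    ¬ TracialVN.CountablyQFSaturated (TracialVN.LinftyTensor μ P) (TracialVN.tensorTrace μ P) ∧
    ∀ (K : ℕ → Type*) [∀ n, NormedAddCommGroup (K n)] [∀ n, InnerProductSpace ℂ (K n)]
      [∀ n, CompleteSpace (K n)] (N : ∀ n, TracialVN.TracialVNA (K n)) (U : Ultrafilter ℕ),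
      (U : Filter ℕ) ≤ Filter.cofinite →
      IsEmpty (TracialVN.LinftyTensor μ P ≃⋆ₐ[ℂ] TracialVN.Ultraproduct N U) ∧
      ∀ S : NonUnitalStarSubalgebra ℂ (TracialVN.Ultraproduct N U),
        TracialVN.IsNorm2Separable (TracialVN.ultraTrace N U) (S : Set (TracialVN.Ultraproduct N U)) →
        IsEmpty (TracialVN.LinftyTensor μ P ≃⋆ₐ[ℂ]
          StarSubalgebra.centralizer ℂ (S : Set (TracialVN.Ultraproduct N U))) :=
  ⟨TracialVN.not_countablyQFSaturated hμ hP, fun _ _ _ _ _ _ hU =>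
    ⟨⟨fun Φ => TracialVN.not_hasUnsolvableSystem_ultraproduct hU
      ((TracialVN.hasUnsolvableSystem_LinftyTensor hμ hP).map Φ)⟩,
    fun S hS => ⟨fun Φ => TracialVN.not_hasUnsolvableSystem_relativeCommutant hU S hS
      ((TracialVN.hasUnsolvableSystem_LinftyTensor hμ hP).map Φ)⟩⟩⟩
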